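/- For a real irreducible doubly stochastic matrix $M$ of size at least $2$, let $\lambda(M)=\min\{1-|\mu| : \mu\neq 1 \text{ a complex eigenvalue of } M\}$ (the absolute spectral gap). For $k\le n$ and a symmetric doubly stochastic matrix $A\in\mathbb{R}^{k\times k}$, the random transition matrix $H_n(A)$ of the cycle-based model is defined as follows: start with the directed cycle on $n$ vertices, every edge having weight $1$; choose $k$ distinct edges uniformly at random, choose one of them uniformly at random and denote it $(e_1,b_2)$, and denote the others $(e_i,b_{i+1})$, $i=2,\dots,k$, following the order of the cycle, with indices modulo $k$; remove these $k$ edges; finally, for all $i,j\in\{1,\dots,k\}$, add a directed edge from $e_j$ to $b_{i+1}$ of weight $A_{ij}=A_{ji}$. The entry of $H_n(A)$ for a pair of vertices is the weight of the edge from the first to the second. **Theorem.** Let $c>0$, $\alpha\ge 0$, $1<\rho_l<\rho_u<\infty$ and $\gamma>7+\alpha$ be constants. Let $n,k\to\infty$ in parallel (along a sequence of pairs of positive integers) with $\rho_l<\frac{\log n}{\log k}<\rho_u$, and for each pair let $A_k\in\mathbb{R}^{k\times k}$ be a symmetric, irreducible, doubly stochastic matrix with $\lambda(A_k)\ge c\log^{-\alpha}k$.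 Then asymptotically almost surely, i.e. with probability tending to $1$, $H_n(A_k)$ is irreducible and $$\lambda(H_n(A_k))\ \ge\ \frac{k}{n\log^{\gamma}k}.$$ -/

import Mathlib

open Filter Topology

/-- The spectral gap `min {1 - |μ| : μ ≠ 1 is an eigenvalue of A}`, over all complex eigenvalues of
the real matrix `A`. It is meant for irreducible doubly stochastic matrices of size at least two,
for which the set is finite and nonempty, so that the infimum is a minimum. -/
noncomputable def spectralGap {ι : Type} [Fintype ι] [DecidableEq ι] (A : Matrix ι ι ℝ) : ℝ :=
  sInf {r : ℝ | ∃ μ : ℂ, μ ≠ 1 ∧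
    Module.End.HasEigenvalue (Matrix.toLin' (A.map Complex.ofReal)) μ ∧ r = 1 - ‖μ‖}

/-- The `k × k` symmetric, doubly stochastic, irreducible matrices whose spectral gap is
at least `c * (log k) ^ (-α)`. -/
def gapClass (c α : ℝ) (k : ℕ) : Set (Matrix (Fin k) (Fin k) ℝ) :=
  {A | A.IsSymm ∧ A ∈ doublyStochastic ℝ (Fin k) ∧ A.IsIrreducible ∧
    c * Real.log k ^ (-α) ≤ spectralGap A}

/-- A choice of `k` distinct edges of the directed `n`-cycle `v → v + 1`, one of which is
distinguished as the first. The edge `v → v + 1` is represented by its tail `v`. -/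
structure CycleConfig (n k : ℕ) where
  /-- tails of the removed edges -/
  removed : Finset (Fin n)
  card_removed : removed.card = k
  /-- tail of the removed edge that receives the first label -/
  first : Fin n
  first_mem : first ∈ removed

/-- Every set of configurations is an event. -/
instance (n k : ℕ) : MeasurableSpace (CycleConfig n k) := ⊤

/-- The law of a random configuration: uniform on all configurations. Each set of `k` edges belongs
to exactly `k` configurations, so this is the same as choosing the `k` edges uniformly and then the
first one uniformly among them. -/
noncomputable def cycleLaw (n k : ℕ) : MeasureTheory.Measure (CycleConfig n k) :=
  ProbabilityTheory.uniformOn Set.univ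

namespace CycleConfig

variable {n k : ℕ}

/-- The label of a removed edge, starting from `0` at the first one and following the order of the
cycle: the number of removed edges met, going along the cycle from the first one, before `v`.
(Subtraction in `Fin n` is modulo `n`.) -/
def label (ω : CycleConfig n k) (v : Fin n) (hv : v ∈ ω.removed) : Fin k :=
  ⟨(ω.removed.filter fun u => u - ω.first < v - ω.first).card, by
    have h : ω.removed.filter (fun u => u - ω.first < v - ω.first) ⊂ ω.removed :=
      Finset.filter_ssubset.2 ⟨v, hv, lt_irrefl _⟩
    exact (Finset.card_lt_card h).trans_eq ω.card_removed⟩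

/-- The transition matrix of the cycle-based model; the entry `(u, w)` is the probability of moving
from `u` to `w`. A vertex whose outgoing cycle edge is kept moves to its successor. If `e_j` and
`e_i` are the tails of the removed edges with labels `j` and `i`, the transition from `e_j` to the
successor of `e_i` (the head of the removed edge with label `i`) has weight `A i j`. -/
noncomputable def transition (A : Matrix (Fin k) (Fin k) ℝ) (ω : CycleConfig n k) :
    Matrix (Fin n) (Fin n) ℝ :=
  fun u w =>
    if hu : u ∈ ω.removed then
      if hw : (finRotate n).symm w ∈ ω.removed then
        A (ω.label ((finRotate n).symm w) hw) (ω.label u hu)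
      else 0
    else if w = finRotate n u then 1 else 0

end CycleConfig

/-! Let `v` be an eigenvector of the transition matrix with eigenvalue `μ ≠ 1` and `|μ|` close to
`1`. Along a kept arc `v` is geometric with ratio `μ`, so it is determined by its values `y` at the
heads of the removed edges, and the equation becomes `(A y) i = μ ^ L i * y (π i)`, with `L i` the
gap lengths and `π` a permutation (`mulVec_heads`). The right side almost preserves the norm, while
`A` contracts vectors of zero sum. Hence `y = m + w` with `w` small (`gap_mul_sum_norm_sq_le`), and
putting this back shows that most `μ ^ L i` are close to `1`
(`norm_sq_mul_sum_norm_pow_sub_one_le`). This is contradictory in two ways (`false_of_eigenvector`).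
If `μ` is very close to `1`, then `v` is almost constant on the whole cycle, although its sum
vanishes because `μ ≠ 1`. Otherwise the randomness of the gaps is used: each stretch of the cycle of
length about `(n / k) log k` contains a gap `L` for which `μ ^ L` is not close to `1`. For one fixed
unit number `ζ`, a block of length about `n / k` contains exactly two removed tails, at a distance
`d` with `ζ ^ d` far from `1`, with probability bounded below (`bernoulliMass_isSpreadPair_ge`).
Order `log k` independent blocks make failure polynomially unlikely, which pays for a union bound
over stretches and over a net of the unit circle, and for replacing uniform `k`-subsets by Bernoulli
subsets (`card_not_hasSpreadPairs_le`). -/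

open Matrix in
theorem mulVec_map_ofReal_re {ι : Type} [Fintype ι] (M : Matrix ι ι ℝ) (v : ι → ℂ) (i : ι) :
    ((M.map Complex.ofReal *ᵥ v) i).re = (M *ᵥ fun j => (v j).re) i := by
  simp [Matrix.mulVec, dotProduct]

open Matrix in
theorem mulVec_map_ofReal_im {ι : Type} [Fintype ι] (M : Matrix ι ι ℝ) (v : ι → ℂ) (i : ι) :
    ((M.map Complex.ofReal *ᵥ v) i).im = (M *ᵥ fun j => (v j).im) i := by
  simp [Matrix.mulVec, dotProduct]

/-! ### Spectral facts about doubly stochastic matrices. -/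

section DoublyStochastic

open Matrix

variable {ι : Type} [Fintype ι] [DecidableEq ι] {M : Matrix ι ι ℝ}

theorem pow_mulVec_of_fixed {v : ι → ℝ} (hv : M *ᵥ v = v) (p : ℕ) : (M ^ p) *ᵥ v = v := by
  induction p with
  | zero => simp
  | succ p ih => rw [pow_succ, ← Matrix.mulVec_mulVec, hv, ih]

/-- Maximum principle: at a maximum `a` the value is an average with weights `(M ^ p) a`, and some
power gives positive weight to any chosen `b`. -/
theorem fixed_eq_of_irreducible (hM : M ∈ doublyStochastic ℝ ι) (hirr : M.IsIrreducible)
    {v : ι → ℝ} (hv : M *ᵥ v = v) (i j : ι) : v i = v j := by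
  have : Nonempty ι := ⟨i⟩
  obtain ⟨a, ha⟩ := Finite.exists_max v
  have key : ∀ b, v b = v a := by
    intro b
    obtain ⟨p, -, hp⟩ := (Matrix.isIrreducible_iff_exists_pow_pos hirr.nonneg).1 hirr a b
    have hMp : M ^ p ∈ doublyStochastic ℝ ι := pow_mem hM p
    have h1 : ∑ c, (M ^ p) a c * (v a - v c) = 0 := by
      have h2 := congrFun (pow_mulVec_of_fixed hv p) a
      simp only [Matrix.mulVec, dotProduct] at h2
      simp only [mul_sub, Finset.sum_sub_distrib, ← Finset.sum_mul,
        sum_row_of_mem_doublyStochastic hMp, h2]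
      ring
    have h3 := (Finset.sum_eq_zero_iff_of_nonneg (fun c _ =>
      mul_nonneg (nonneg_of_mem_doublyStochastic hMp) (sub_nonneg.2 (ha c)))).1 h1 b
      (Finset.mem_univ _)
    rcases mul_eq_zero.1 h3 with h | h
    · exact absurd h hp.ne'
    · linarith
  rw [key i, key j]

theorem complex_fixed_eq_of_irreducible (hM : M ∈ doublyStochastic ℝ ι) (hirr : M.IsIrreducible)
    {v : ι → ℂ} (hv : M.map Complex.ofReal *ᵥ v = v) (i j : ι) : v i = v j := by
  apply Complex.ext
  · refine fixed_eq_of_irreducible hM hirr (v := fun j => (v j).re) (funext fun a => ?_) i j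
    rw [← mulVec_map_ofReal_re, hv]
  · refine fixed_eq_of_irreducible hM hirr (v := fun j => (v j).im) (funext fun a => ?_) i j
    rw [← mulVec_map_ofReal_im, hv]

/-- The indicator `v` of the states reachable from `i` satisfies `v ≤ M v`. Column sums equal to `1`
force equality, so `v` is fixed, hence constant. -/
theorem irreducible_of_fixed_eq (hM : M ∈ doublyStochastic ℝ ι)
    (h : ∀ v : ι → ℝ, M *ᵥ v = v → ∀ i j, v i = v j) : M.IsIrreducible := by
  classical
  have hnn : ∀ i j, 0 ≤ M i j := fun i j => nonneg_of_mem_doublyStochastic hM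
  rw [Matrix.isIrreducible_iff_exists_pow_pos hnn]
  intro i
  let v : ι → ℝ := fun j => if ∃ p > 0, 0 < (M ^ p) i j then 1 else 0
  have hv01 : ∀ b, 0 ≤ v b := fun b => by simp only [v]; split_ifs <;> norm_num
  have hle : ∀ a, v a ≤ (M *ᵥ v) a := by
    intro a
    by_cases ha : ∃ p > 0, 0 < (M ^ p) i a
    · have h1 : ∀ b, M a b * v b = M a b := by
        intro b
        rcases (hnn a b).eq_or_lt with h0 | h0
        · rw [← h0, zero_mul]
        · obtain ⟨p, hp, hpa⟩ := ha
          have : v b = 1 := if_pos ⟨p + 1, by omega, by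
            rw [pow_succ, Matrix.mul_apply]
            exact Finset.sum_pos' (fun c _ => mul_nonneg
              (nonneg_of_mem_doublyStochastic (pow_mem hM p)) (hnn c b))
              ⟨a, Finset.mem_univ _, mul_pos hpa h0⟩⟩
          rw [this, mul_one]
      simp only [Matrix.mulVec, dotProduct, h1, sum_row_of_mem_doublyStochastic hM]
      simp only [v]; (split_ifs; norm_num)
    · have : v a = 0 := if_neg ha
      rw [this]
      exact Finset.sum_nonneg fun b _ => mul_nonneg (hnn a b) (hv01 b)
  have hfix : M *ᵥ v = v := by
    have hs := sum_mulVec_of_mem_doublyStochastic (x := v) hM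
    have := (Finset.sum_eq_sum_iff_of_le (fun a _ => hle a)).1 hs.symm
    exact funext fun a => (this a (Finset.mem_univ _)).symm
  have hex : ∃ b, 0 < M i b := by
    by_contra! hcon
    have := sum_row_of_mem_doublyStochastic hM i
    linarith [Finset.sum_nonpos fun b (_ : b ∈ Finset.univ) => hcon b]
  obtain ⟨b, hb⟩ := hex
  have hvb : v b = 1 := if_pos ⟨1, one_pos, by rwa [pow_one]⟩
  intro j
  have hvj : v j = 1 := (h v hfix j b).trans hvb
  by_contra hcon
  have : v j = 0 := if_neg hcon
  linarith

theorem norm_eigenvalue_le_one (hM : M ∈ doublyStochastic ℝ ι) {μ : ℂ} {v : ι → ℂ} (hv0 : v ≠ 0)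
    (hv : M.map Complex.ofReal *ᵥ v = μ • v) : ‖μ‖ ≤ 1 := by
  obtain ⟨i, hi⟩ := Function.ne_iff.1 hv0
  have : Nonempty ι := ⟨i⟩
  obtain ⟨a, ha⟩ := Finite.exists_max fun j => ‖v j‖
  have hpos : 0 < ‖v a‖ := (norm_pos_iff.2 hi).trans_le (ha i)
  have h1 := congrFun hv a
  simp only [Matrix.mulVec, dotProduct, Pi.smul_apply, smul_eq_mul, Matrix.map_apply] at h1
  have h2 : ‖μ‖ * ‖v a‖ ≤ 1 * ‖v a‖ := by
    rw [← norm_mul, ← h1, ← sum_row_of_mem_doublyStochastic hM a, Finset.sum_mul]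
    refine (norm_sum_le _ _).trans (Finset.sum_le_sum fun b _ => ?_)
    rw [norm_mul, Complex.norm_real, Real.norm_of_nonneg (nonneg_of_mem_doublyStochastic hM)]
    exact mul_le_mul_of_nonneg_left (ha b) (nonneg_of_mem_doublyStochastic hM)
  exact le_of_mul_le_mul_right h2 hpos

theorem hasEigenvalue_toLin'_iff_exists {N : Matrix ι ι ℂ} {μ : ℂ} :
    Module.End.HasEigenvalue (Matrix.toLin' N) μ ↔ ∃ v : ι → ℂ, v ≠ 0 ∧ N *ᵥ v = μ • v := by
  constructor
  · intro h
    obtain ⟨v, hv⟩ := h.exists_hasEigenvector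
    exact ⟨v, hv.2, by simpa using hv.apply_eq_smul⟩
  · rintro ⟨v, hv0, hv⟩
    exact Module.End.hasEigenvalue_of_hasEigenvector (x := v)
      ⟨Module.End.mem_eigenspace_iff.2 (by simpa using hv), hv0⟩

theorem spectralGap_le_one_sub_norm (hM : M ∈ doublyStochastic ℝ ι) {μ : ℂ} (hμ : μ ≠ 1)
    {v : ι → ℂ} (hv0 : v ≠ 0) (hv : M.map Complex.ofReal *ᵥ v = μ • v) :
    spectralGap M ≤ 1 - ‖μ‖ := by
  refine csInf_le ⟨0, ?_⟩ ⟨μ, hμ, hasEigenvalue_toLin'_iff_exists.2 ⟨v, hv0, hv⟩, rfl⟩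
  rintro r ⟨ν, -, hν, rfl⟩
  obtain ⟨w, hw0, hw⟩ := hasEigenvalue_toLin'_iff_exists.1 hν
  linarith [norm_eigenvalue_le_one hM hw0 hw]

theorem sum_mulVec_map_ofReal (hM : M ∈ doublyStochastic ℝ ι) (v : ι → ℂ) :
    ∑ i, (M.map Complex.ofReal *ᵥ v) i = ∑ i, v i := by
  simp only [Matrix.mulVec, dotProduct, Matrix.map_apply]
  rw [Finset.sum_comm]
  refine Finset.sum_congr rfl fun j _ => ?_
  rw [← Finset.sum_mul, ← Complex.ofReal_sum, sum_col_of_mem_doublyStochastic hM]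
  simp

theorem mulVec_map_ofReal_const (hM : M ∈ doublyStochastic ℝ ι) (m : ℂ) :
    M.map Complex.ofReal *ᵥ (fun _ => m) = fun _ => m := by
  funext i
  simp only [Matrix.mulVec, dotProduct, Matrix.map_apply]
  rw [← Finset.sum_mul, ← Complex.ofReal_sum, sum_row_of_mem_doublyStochastic hM]
  simp

/-- On vectors with vanishing sum, a symmetric irreducible doubly stochastic matrix contracts. -/
theorem sum_norm_sq_mulVec_le (hsymm : M.IsSymm) (hM : M ∈ doublyStochastic ℝ ι)
    (hirr : M.IsIrreducible) {δ : ℝ} (hδ : 0 ≤ δ) (hgap : δ ≤ spectralGap M) {w : ι → ℂ}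
    (hw : ∑ i, w i = 0) :
    ∑ i, ‖(M.map Complex.ofReal *ᵥ w) i‖ ^ 2 ≤ (1 - δ) * ∑ i, ‖w i‖ ^ 2 := by
  have hH : (M.map Complex.ofReal).IsHermitian := by
    ext i j
    simp [Matrix.conjTranspose_apply, hsymm.apply i j]
  set b := hH.eigenvectorBasis
  have hexp : ∀ x : ι → ℂ, ∑ i, ‖x i‖ ^ 2 = ∑ j, ‖inner ℂ (b j) (WithLp.toLp 2 x)‖ ^ 2 := by
    intro x
    rw [b.sum_sq_norm_inner_right, EuclideanSpace.norm_sq_eq]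
  have hinner : ∀ j, inner ℂ (b j) (WithLp.toLp 2 (M.map Complex.ofReal *ᵥ w)) =
      (hH.eigenvalues j : ℂ) * inner ℂ (b j) (WithLp.toLp 2 w) := by
    intro j
    have h1 := hH.mulVec_eigenvectorBasis j
    simp only [EuclideanSpace.inner_eq_star_dotProduct]
    have h2 : star (b j : ι → ℂ) ᵥ* M.map Complex.ofReal =
        star (M.map Complex.ofReal *ᵥ (b j : ι → ℂ)) := by
      rw [Matrix.star_mulVec, hH.eq]
    rw [dotProduct_comm, Matrix.dotProduct_mulVec, h2, h1]
    simp [dotProduct_comm, b]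
  rw [hexp, hexp w, Finset.mul_sum]
  refine Finset.sum_le_sum fun j _ => ?_
  rw [hinner, norm_mul, mul_pow]
  have hev : M.map Complex.ofReal *ᵥ (b j : ι → ℂ) = (hH.eigenvalues j : ℂ) • (b j : ι → ℂ) := by
    simpa using hH.mulVec_eigenvectorBasis j
  have hb0 : (b j : ι → ℂ) ≠ 0 := by
    intro h0
    have : ‖b j‖ = 1 := b.orthonormal.1 j
    rw [show b j = 0 from by ext i; exact congrFun h0 i] at this
    simp at this
  -- Eigenvectors for `1` are constant, hence orthogonal to `w`; every other eigenvalue has modulus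
  -- at most `1 - δ`, and `(1 - δ) ^ 2 ≤ 1 - δ`.
  by_cases h1 : (hH.eigenvalues j : ℂ) = 1
  · have hconst := complex_fixed_eq_of_irreducible hM hirr (v := (b j : ι → ℂ))
      (by rw [hev, h1, one_smul])
    have h0 : inner ℂ (b j) (WithLp.toLp 2 w) = 0 := by
      rcases isEmpty_or_nonempty ι with he | ⟨⟨a⟩⟩
      · exact he.elim j
      · simp only [EuclideanSpace.inner_eq_star_dotProduct, dotProduct]
        rw [Finset.sum_congr rfl fun i _ => by
          rw [Pi.star_apply, hconst i a], ← Finset.sum_mul, hw, zero_mul]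
    rw [h0]; simp
  · refine mul_le_mul_of_nonneg_right ?_ (sq_nonneg _)
    have h2 := spectralGap_le_one_sub_norm hM h1 hb0 hev
    nlinarith [norm_nonneg (hH.eigenvalues j : ℂ)]

/-- A doubly stochastic matrix which is not the identity has an eigenvalue different from `1`. -/
theorem exists_eigenvalue_ne_one (hM : M ∈ doublyStochastic ℝ ι) {a : ι} (ha : M a a = 0) :
    ∃ μ : ℂ, μ ≠ 1 ∧ Module.End.HasEigenvalue (Matrix.toLin' (M.map Complex.ofReal)) μ := by
  by_contra! hcon
  have hroots : ∀ μ ∈ (M.map Complex.ofReal).charpoly.roots, μ = 1 := by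
    intro μ hμ
    by_contra h1
    refine hcon μ h1 ?_
    rw [Module.End.hasEigenvalue_iff_isRoot_charpoly, Matrix.charpoly_toLin']
    exact Polynomial.isRoot_of_mem_roots hμ
  -- If all eigenvalues were `1`, the trace would equal the size, but the diagonal entries are at
  -- most `1` and one of them is `0`.
  have htr := Matrix.trace_eq_sum_roots_charpoly (M.map Complex.ofReal)
  rw [Multiset.eq_replicate_card.2 hroots, Multiset.sum_replicate,
    ← (IsAlgClosed.splits (M.map Complex.ofReal).charpoly).natDegree_eq_card_roots,
    Matrix.charpoly_natDegree_eq_dim] at htr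
  have hre := congrArg Complex.re htr
  simp [Matrix.trace] at hre
  have hlt : ∑ x, M x x < ∑ _x : ι, (1 : ℝ) :=
    Finset.sum_lt_sum (fun i _ => le_one_of_mem_doublyStochastic hM)
      ⟨a, Finset.mem_univ _, by rw [ha]; exact one_pos⟩
  simp at hlt
  linarith

end DoublyStochastic

/-! ### Bernoulli subsets and their comparison with uniform `k`-subsets. -/

section BernoulliSubsets

open Finset

/-- The probability that a random subset of `U`, containing each point independently with
probability `q`, satisfies `P`. -/
noncomputable def bernoulliMass (q : ℝ) (U : Finset ℕ) (P : Finset ℕ → Prop) : ℝ :=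
  open Classical in ∑ R ∈ U.powerset with P R, q ^ #R * (1 - q) ^ (#U - #R)

theorem bernoulliMass_true (q : ℝ) (U : Finset ℕ) : bernoulliMass q U (fun _ => True) = 1 := by
  classical
  simp only [bernoulliMass, Finset.filter_true]
  rw [Finset.sum_pow_mul_eq_add_pow]
  simp

theorem bernoulliMass_not (q : ℝ) (U : Finset ℕ) (P : Finset ℕ → Prop) :
    bernoulliMass q U (fun R => ¬ P R) = 1 - bernoulliMass q U P := by
  classical
  rw [← bernoulliMass_true q U]
  simp only [bernoulliMass, Finset.filter_true]
  rw [← Finset.sum_filter_add_sum_filter_not U.powerset P]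
  ring

theorem bernoulliMass_nonneg {q : ℝ} (hq : 0 ≤ q) (hq1 : q ≤ 1) (U : Finset ℕ)
    (P : Finset ℕ → Prop) : 0 ≤ bernoulliMass q U P :=
  Finset.sum_nonneg fun _ _ => mul_nonneg (pow_nonneg hq _) (pow_nonneg (by linarith) _)

/-- Independence over disjoint sets: the weight factors under `R ↦ (R ∩ U, R ∩ V)`. -/
theorem bernoulliMass_union (q : ℝ) {U V : Finset ℕ} (hUV : Disjoint U V)
    (P Q : Finset ℕ → Prop) :
    bernoulliMass q (U ∪ V) (fun R => P (R ∩ U) ∧ Q (R ∩ V)) =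
      bernoulliMass q U P * bernoulliMass q V Q := by
  classical
  have hU : ∀ S T : Finset ℕ, S ⊆ U → T ⊆ V → (S ∪ T) ∩ U = S := by
    intro S T hS hT
    rw [Finset.union_inter_distrib_right, Finset.inter_eq_left.2 hS,
      Finset.disjoint_iff_inter_eq_empty.1 (hUV.symm.mono_left hT), Finset.union_empty]
  have hV : ∀ S T : Finset ℕ, S ⊆ U → T ⊆ V → (S ∪ T) ∩ V = T := by
    intro S T hS hT
    rw [Finset.union_inter_distrib_right, Finset.inter_eq_left.2 hT,
      Finset.disjoint_iff_inter_eq_empty.1 (hUV.mono_left hS), Finset.empty_union]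
  simp only [bernoulliMass]
  rw [Finset.sum_mul_sum, ← Finset.sum_product']
  refine Finset.sum_nbij' (fun R => (R ∩ U, R ∩ V)) (fun p => p.1 ∪ p.2) ?_ ?_ ?_ ?_ ?_
  · intro R hR
    simp only [Finset.mem_filter, Finset.mem_powerset, Finset.mem_product] at hR ⊢
    exact ⟨⟨Finset.inter_subset_right, hR.2.1⟩, ⟨Finset.inter_subset_right, hR.2.2⟩⟩
  · rintro ⟨S, T⟩ h
    simp only [Finset.mem_filter, Finset.mem_powerset, Finset.mem_product] at h ⊢
    rw [hU S T h.1.1 h.2.1, hV S T h.1.1 h.2.1]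
    exact ⟨Finset.union_subset_union h.1.1 h.2.1, h.1.2, h.2.2⟩
  · intro R hR
    simp only [Finset.mem_filter, Finset.mem_powerset] at hR
    simp only
    rw [← Finset.inter_union_distrib_left, Finset.inter_eq_left.2 hR.1]
  · rintro ⟨S, T⟩ h
    simp only [Finset.mem_filter, Finset.mem_powerset, Finset.mem_product] at h
    simp only
    rw [hU S T h.1.1 h.2.1, hV S T h.1.1 h.2.1]
  · intro R hR
    simp only [Finset.mem_filter, Finset.mem_powerset] at hR
    have h1 : #R = #(R ∩ U) + #(R ∩ V) := by
      rw [← Finset.card_union_of_disjoint (hUV.mono Finset.inter_subset_right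
        Finset.inter_subset_right), ← Finset.inter_union_distrib_left,
        Finset.inter_eq_left.2 hR.1]
    have h2 : #(R ∩ U) ≤ #U := Finset.card_le_card Finset.inter_subset_right
    have h3 : #(R ∩ V) ≤ #V := Finset.card_le_card Finset.inter_subset_right
    have h4 : #(U ∪ V) - #R = (#U - #(R ∩ U)) + (#V - #(R ∩ V)) := by
      rw [Finset.card_union_of_disjoint hUV]; omega
    rw [h4, h1, pow_add, pow_add]
    ring

theorem bernoulliMass_congr {q : ℝ} {U : Finset ℕ} {P Q : Finset ℕ → Prop}
    (h : ∀ R ⊆ U, (P R ↔ Q R)) : bernoulliMass q U P = bernoulliMass q U Q := by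
  classical
  simp only [bernoulliMass]
  rw [Finset.filter_congr fun R hR => h R (Finset.mem_powerset.1 hR)]

theorem bernoulliMass_inter (q : ℝ) {U W : Finset ℕ} (hUW : U ⊆ W) (P : Finset ℕ → Prop) :
    bernoulliMass q W (fun R => P (R ∩ U)) = bernoulliMass q U P := by
  have h := bernoulliMass_union q (Finset.disjoint_sdiff (s := U) (t := W)) P (fun _ => True)
  rw [bernoulliMass_true, mul_one, Finset.union_sdiff_of_subset hUW] at h
  rw [← h]
  exact bernoulliMass_congr fun R _ => by simp

/-- Independence of consecutive blocks of length `s`. -/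
theorem bernoulliMass_blocks_le {q : ℝ} (hq : 0 ≤ q) (hq1 : q ≤ 1) (s : ℕ)
    (P : Finset ℕ → Prop) {x : ℝ} (hx : 0 ≤ x)
    (hP : ∀ a, bernoulliMass q (Ico a (a + s)) P ≤ x) (a m : ℕ) :
    bernoulliMass q (Ico a (a + m * s))
      (fun R => ∀ i < m, P (R ∩ Ico (a + i * s) (a + i * s + s))) ≤ x ^ m := by
  induction m with
  | zero => simpa using (bernoulliMass_true q (Ico a (a + 0 * s))).le
  | succ m ih =>
    have hdisj : Disjoint (Ico a (a + m * s)) (Ico (a + m * s) (a + m * s + s)) :=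
      Finset.Ico_disjoint_Ico_consecutive _ _ _
    have hun : Ico a (a + m * s) ∪ Ico (a + m * s) (a + m * s + s) =
        Ico a (a + (m + 1) * s) := by
      rw [Finset.Ico_union_Ico_eq_Ico (by omega) (by omega)]
      congr 1; ring
    have h := bernoulliMass_union q hdisj
      (fun R => ∀ i < m, P (R ∩ Ico (a + i * s) (a + i * s + s))) P
    rw [hun] at h
    have hcongr : bernoulliMass q (Ico a (a + (m + 1) * s))
        (fun R => ∀ i < m + 1, P (R ∩ Ico (a + i * s) (a + i * s + s))) =
        bernoulliMass q (Ico a (a + (m + 1) * s)) (fun R =>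
          (∀ i < m, P (R ∩ Ico a (a + m * s) ∩ Ico (a + i * s) (a + i * s + s))) ∧
          P (R ∩ Ico (a + m * s) (a + m * s + s))) := by
      refine bernoulliMass_congr fun R _ => ?_
      have hi : ∀ i < m, R ∩ Ico a (a + m * s) ∩ Ico (a + i * s) (a + i * s + s) =
          R ∩ Ico (a + i * s) (a + i * s + s) := by
        intro i hi
        have h1 : (i + 1) * s ≤ m * s := Nat.mul_le_mul_right _ hi
        have h2 : Ico (a + i * s) (a + i * s + s) ⊆ Ico a (a + m * s) :=
          Finset.Ico_subset_Ico (by omega) (by linarith)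
        rw [Finset.inter_assoc, Finset.inter_eq_right.2 h2]
      constructor
      · intro hR
        exact ⟨fun i him => by rw [hi i him]; exact hR i (by omega), hR m (by omega)⟩
      · rintro ⟨h1, h2⟩ i him
        rcases Nat.lt_succ_iff_lt_or_eq.1 him with h3 | rfl
        · rw [← hi i h3]; exact h1 i h3
        · exact h2
    rw [hcongr, h, pow_succ]
    exact mul_le_mul ih (hP _) (bernoulliMass_nonneg hq hq1 _ _) (pow_nonneg hx _)

/-- The binomial distribution with parameters `n` and `k / n` has mass at least `1 / (n + 1)`
at `k`. -/
theorem one_le_succ_mul_binomial {n k : ℕ} (hkn : k < n) :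
    1 ≤ (n + 1 : ℝ) * (n.choose k * ((k / n : ℝ) ^ k * (1 - k / n : ℝ) ^ (n - k))) := by
  set q : ℝ := k / n with hq
  have hn : (0 : ℝ) < n := by exact_mod_cast (by omega : 0 < n)
  have hqn : q * n = k := by rw [hq]; field_simp
  have hq0 : 0 ≤ q := by positivity
  have hq1 : q < 1 := by rw [hq, div_lt_one hn]; exact_mod_cast hkn
  let b : ℕ → ℝ := fun j => n.choose j * (q ^ j * (1 - q) ^ (n - j))
  have hb0 : ∀ j, 0 ≤ b j := fun j =>
    mul_nonneg (by positivity) (mul_nonneg (by positivity) (pow_nonneg (by linarith) _))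
  -- This ratio of consecutive binomial weights, with `q * n = k`, shows that they increase up to
  -- `k` and decrease afterwards. The largest of `n + 1` weights of sum `1` is at least `1 / (n +
  -- 1)`.
  have hstep : ∀ j < n, ((j + 1 : ℝ) * (1 - q)) * b (j + 1) = ((n - j : ℝ) * q) * b j := by
    intro j hj
    have h1 : (n.choose (j + 1) : ℝ) * (j + 1) = n.choose j * (n - j) := by
      have := Nat.choose_succ_right_eq n j
      rw [← Nat.cast_sub hj.le]
      exact_mod_cast this
    have h2 : n - j = (n - (j + 1)) + 1 := by omega
    simp only [b]
    rw [h2, pow_succ, pow_succ]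
    linear_combination (1 - q) * (q ^ j * q * (1 - q) ^ (n - (j + 1))) * h1
  have hup : ∀ j < k, b j ≤ b (j + 1) := by
    intro j hj
    have hjk : (j + 1 : ℝ) ≤ k := by exact_mod_cast hj
    refine le_of_mul_le_mul_left ?_ (mul_pos (by positivity : (0 : ℝ) < j + 1) (sub_pos.2 hq1))
    rw [hstep j (by omega)]
    exact mul_le_mul_of_nonneg_right (by nlinarith) (hb0 j)
  have hdown : ∀ j, k ≤ j → j < n → b (j + 1) ≤ b j := by
    intro j hj hjn
    have hjk : (k : ℝ) ≤ j := by exact_mod_cast hj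
    refine le_of_mul_le_mul_left ?_ (mul_pos (by positivity : (0 : ℝ) < j + 1) (sub_pos.2 hq1))
    rw [hstep j (by omega)]
    exact mul_le_mul_of_nonneg_right (by nlinarith) (hb0 j)
  have hmax : ∀ j ≤ n, b j ≤ b k := by
    intro j hj
    rcases le_total j k with h | h
    · exact Nat.decreasingInduction (motive := fun i _ => b i ≤ b k)
        (fun i hi ih => (hup i hi).trans ih) le_rfl h
    · induction j, h using Nat.le_induction with
      | base => exact le_rfl
      | succ i hi ih => exact (hdown i hi (by omega)).trans (ih (by omega))
  have hsum : ∑ j ∈ range (n + 1), b j = 1 := by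
    have := add_pow q (1 - q) n
    rw [add_sub_cancel, one_pow] at this
    rw [this]
    exact Finset.sum_congr rfl fun j _ => by simp only [b]; ring
  refine hsum.ge.trans ?_
  refine (Finset.sum_le_card_nsmul _ _ (b k) fun j hj => hmax j ?_).trans ?_
  · have := Finset.mem_range.1 hj; omega
  · simp [b]

/-- Conditioning Bernoulli subsets of `range n` with mean size `k` on having exactly `k` elements
costs a factor of at most `n + 1`. -/
theorem card_filter_powersetCard_le {n k : ℕ} (hkn : k < n) (P : Finset ℕ → Prop)
    [DecidablePred P] :
    (#{R ∈ powersetCard k (range n) | P R} : ℝ) ≤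
      (n + 1) * n.choose k * bernoulliMass (k / n) (range n) P := by
  classical
  set q : ℝ := k / n with hq
  have hn : (0 : ℝ) < n := by exact_mod_cast (by omega : 0 < n)
  have hq0 : 0 ≤ q := by positivity
  have hq1 : q < 1 := by rw [hq, div_lt_one hn]; exact_mod_cast hkn
  set N : ℝ := (#{R ∈ powersetCard k (range n) | P R} : ℝ) with hN
  -- All `k`-subsets have the same Bernoulli weight, so the count times this weight is a part of the
  -- mass.
  have h1 : N * (q ^ k * (1 - q) ^ (n - k)) ≤ bernoulliMass q (range n) P := by
    rw [hN, ← nsmul_eq_mul, ← Finset.sum_const]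
    simp only [bernoulliMass]
    have h2 : ∀ R ∈ ({R ∈ powersetCard k (range n) | P R} : Finset (Finset ℕ)),
        q ^ k * (1 - q) ^ (n - k) = q ^ #R * (1 - q) ^ (#(range n) - #R) := by
      intro R hR
      rw [(Finset.mem_powersetCard.1 (Finset.mem_filter.1 hR).1).2, card_range]
    rw [Finset.sum_congr rfl h2]
    refine Finset.sum_le_sum_of_subset_of_nonneg ?_ fun R _ _ =>
      mul_nonneg (pow_nonneg hq0 _) (pow_nonneg (by linarith) _)
    intro R hR
    simp only [Finset.mem_filter, Finset.mem_powersetCard, Finset.mem_powerset] at hR ⊢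
    exact ⟨hR.1.1, hR.2⟩
  have h3 := one_le_succ_mul_binomial hkn
  calc N ≤ N * ((n + 1 : ℝ) * (n.choose k * (q ^ k * (1 - q) ^ (n - k)))) :=
        le_mul_of_one_le_right (by positivity) h3
    _ = (n + 1) * n.choose k * (N * (q ^ k * (1 - q) ^ (n - k))) := by ring
    _ ≤ _ := mul_le_mul_of_nonneg_left h1 (by positivity)

end BernoulliSubsets

/-! ### Spread pairs appear in every long interval, with high probability. -/

section GoodPairs

open Finset

/-- The set `S` consists of two points whose distance `d` satisfies `t ≤ ‖ζ ^ d - 1‖`. -/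
def IsSpreadPair (ζ : ℂ) (t : ℝ) (S : Finset ℕ) : Prop :=
  ∃ r d : ℕ, 1 ≤ d ∧ t ≤ ‖ζ ^ d - 1‖ ∧ S = {r, r + d}

/-- If `ζ` is not too close to `1` then some small power of it is far from `1`. -/
theorem exists_norm_pow_sub_one_ge {ζ : ℂ} {t : ℝ} (ht0 : 0 < t) (ht : t ≤ 1 / 4)
    {H : ℕ} (hH : 0 < H) (hζ : 4 * t / H ≤ ‖ζ - 1‖) :
    ∃ h ≤ H, 2 * t ≤ ‖ζ ^ h - 1‖ := by
  by_contra! hcon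
  have hH' : (0 : ℝ) < H := by exact_mod_cast hH
  have hgeom := mul_geom_sum ζ H
  -- All the powers lie within `2 * t ≤ 1 / 2` of `1`, so their sum is large; then `ζ ^ H - 1 = (ζ -
  -- 1) * ∑ ζ ^ i` is at least `(4 * t / H) * (H / 2) = 2 * t` in modulus.
  have hsum : (H : ℝ) / 2 ≤ ‖∑ i ∈ range H, ζ ^ i‖ := by
    have h1 : ∑ i ∈ range H, ζ ^ i = (H : ℂ) + ∑ i ∈ range H, (ζ ^ i - 1) := by
      rw [Finset.sum_sub_distrib]; simp
    have h2 : ‖∑ i ∈ range H, (ζ ^ i - 1)‖ ≤ H * (2 * t) := by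
      refine (norm_sum_le _ _).trans ?_
      refine (Finset.sum_le_card_nsmul _ _ (2 * t) fun i hi =>
        (hcon i (Finset.mem_range.1 hi).le).le).trans ?_
      simp
    have h3 : (H : ℝ) - H * (2 * t) ≤ ‖∑ i ∈ range H, ζ ^ i‖ := by
      rw [h1]
      have := norm_sub_le ((H : ℂ) + ∑ i ∈ range H, (ζ ^ i - 1)) (∑ i ∈ range H, (ζ ^ i - 1))
      rw [add_sub_cancel_right, Complex.norm_natCast] at this
      linarith
    nlinarith
  have h4 := hcon H le_rfl
  rw [← hgeom, norm_mul] at h4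
  have h5 : 4 * t ≤ ‖ζ - 1‖ * H := by rwa [div_le_iff₀ hH'] at hζ
  nlinarith [norm_nonneg (ζ - 1)]

/-- Choose `h ≤ 2 * Q` with `‖ζ ^ h - 1‖ ≥ 2 * t`. Since `ζ ^ d` and `ζ ^ (d + h)` are `2 * t`
apart, one of `d`, `d + h` is good for every `d ≤ Q`. -/
theorem card_spread_distances_ge {ζ : ℂ} (hζ1 : ‖ζ‖ = 1) {t : ℝ} (ht0 : 0 < t) (ht : t ≤ 1 / 4)
    {Q : ℕ} (hQ : 0 < Q) (hζ : 2 * t / Q ≤ ‖ζ - 1‖) :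
    Q ≤ 2 * #{d ∈ Icc 1 (3 * Q) | t ≤ ‖ζ ^ d - 1‖} := by
  obtain ⟨h, hh, hht⟩ := exists_norm_pow_sub_one_ge ht0 ht (H := 2 * Q) (by omega)
    (by push_cast; convert hζ using 1; field_simp; ring)
  set G : Finset ℕ := {d ∈ Icc 1 (3 * Q) | t ≤ ‖ζ ^ d - 1‖}
  have hcover : Icc 1 Q ⊆ G ∪ G.image fun d => d - h := by
    intro d hd
    rw [Finset.mem_Icc] at hd
    by_cases h1 : t ≤ ‖ζ ^ d - 1‖
    · exact Finset.mem_union_left _ (Finset.mem_filter.2 ⟨Finset.mem_Icc.2 (by omega), h1⟩)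
    · refine Finset.mem_union_right _ (Finset.mem_image.2 ⟨d + h, Finset.mem_filter.2
        ⟨Finset.mem_Icc.2 (by omega), ?_⟩, by omega⟩)
      push Not at h1
      have h2 : ‖ζ ^ (d + h) - ζ ^ d‖ = ‖ζ ^ h - 1‖ := by
        rw [pow_add, ← mul_sub_one, norm_mul, norm_pow, hζ1, one_pow, one_mul]
      have h3 := norm_sub_le_norm_sub_add_norm_sub (ζ ^ (d + h)) 1 (ζ ^ d)
      rw [norm_sub_rev 1 (ζ ^ d)] at h3
      linarith
  have h1 := Finset.card_le_card hcover
  have h2 := Finset.card_union_le G (G.image fun d => d - h)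
  have h3 : #(G.image fun d => d - h) ≤ #G := Finset.card_image_le
  simp only [Nat.card_Icc] at h1
  omega

/-- A block of length comparable with `1 / q` is a spread pair with probability bounded below. -/
theorem bernoulliMass_isSpreadPair_ge {ζ : ℂ} (hζ1 : ‖ζ‖ = 1) {t : ℝ} (ht0 : 0 < t)
    (ht : t ≤ 1 / 4) {Q : ℕ} (hζ : 2 * t / Q ≤ ‖ζ - 1‖) {q : ℝ}
    (hqQ : 1 / 16 ≤ q * Q) (hqQ' : q * Q ≤ 1 / 8) (a : ℕ) :
    1 / 1024 ≤ bernoulliMass q (Ico a (a + 4 * Q)) (IsSpreadPair ζ t) := by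
  classical
  have hQ : 0 < Q := by
    rcases Nat.eq_zero_or_pos Q with rfl | h
    · norm_num at hqQ
    · exact h
  have hQ' : (1 : ℝ) ≤ Q := by exact_mod_cast hQ
  have hq0 : 0 ≤ q := by
    by_contra! hneg
    nlinarith
  have hq1 : q ≤ 1 := by nlinarith
  set G : Finset ℕ := {d ∈ Icc 1 (3 * Q) | t ≤ ‖ζ ^ d - 1‖} with hG
  have hcard := card_spread_distances_ge hζ1 ht0 ht hQ hζ
  let f : ℕ × ℕ → Finset ℕ := fun p => {a + p.1, a + p.1 + p.2}
  have hGd : ∀ d ∈ G, 1 ≤ d ∧ d ≤ 3 * Q ∧ t ≤ ‖ζ ^ d - 1‖ := by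
    intro d hd
    simp only [hG, Finset.mem_filter, Finset.mem_Icc] at hd
    exact ⟨hd.1.1, hd.1.2, hd.2⟩
  have hfcard : ∀ p ∈ range Q ×ˢ G, #(f p) = 2 := by
    intro p hp
    have := hGd p.2 (Finset.mem_product.1 hp).2
    exact Finset.card_pair (by omega)
  have hinj : Set.InjOn f (range Q ×ˢ G : Finset (ℕ × ℕ)) := by
    rintro ⟨r, d⟩ hp ⟨r', d'⟩ hp' he
    have h1 := hGd d (Finset.mem_product.1 (Finset.mem_coe.1 hp)).2
    have h2 := hGd d' (Finset.mem_product.1 (Finset.mem_coe.1 hp')).2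
    simp only [f] at he
    have e1 : a + r ∈ ({a + r', a + r' + d'} : Finset ℕ) := he ▸ by simp
    have e2 : a + r + d ∈ ({a + r', a + r' + d'} : Finset ℕ) := he ▸ by simp
    have e3 : a + r' ∈ ({a + r, a + r + d} : Finset ℕ) := he ▸ by simp
    simp only [Finset.mem_insert, Finset.mem_singleton] at e1 e2 e3
    ext <;> simp only <;> omega
  have hsub : (range Q ×ˢ G).image f ⊆
      {R ∈ (Ico a (a + 4 * Q)).powerset | IsSpreadPair ζ t R} := by
    intro R hR
    obtain ⟨⟨r, d⟩, hp, rfl⟩ := Finset.mem_image.1 hR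
    rw [Finset.mem_product, Finset.mem_range] at hp
    have h1 := hGd d hp.2
    simp only at hp
    refine Finset.mem_filter.2 ⟨Finset.mem_powerset.2 ?_, a + r, d, h1.1, h1.2.2, rfl⟩
    intro x hx
    simp only [f, Finset.mem_insert, Finset.mem_singleton] at hx
    rw [Finset.mem_Ico]
    omega
  have hpow : (1 / 2 : ℝ) ≤ (1 - q) ^ (4 * Q - 2) := by
    have h1 : (1 / 2 : ℝ) ≤ (1 - q) ^ (4 * Q) := by
      have := one_add_mul_le_pow (a := -q) (by linarith) (4 * Q)
      push_cast at this
      rw [← sub_eq_add_neg] at this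
      nlinarith
    exact h1.trans (pow_le_pow_of_le_one (by linarith) (by linarith) (Nat.sub_le _ _))
  simp only [bernoulliMass]
  -- There are `Q` starting points and at least `Q / 2` good distances, and each pair has
  -- probability at least `q ^ 2 / 2`; the total is at least `(q * Q) ^ 2 / 4 ≥ 1 / 1024`.
  calc (1 / 1024 : ℝ) ≤ (Q * (Q / 2)) * (q ^ 2 * (1 / 2)) := by nlinarith
    _ ≤ (Q * #G) * (q ^ 2 * (1 - q) ^ (4 * Q - 2)) := by
        have : (Q : ℝ) ≤ 2 * #G := by exact_mod_cast hcard
        gcongr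
        linarith
    _ = ∑ R ∈ (range Q ×ˢ G).image f, q ^ #R * (1 - q) ^ (#(Ico a (a + 4 * Q)) - #R) := by
        rw [Finset.sum_image hinj, Finset.sum_congr rfl fun p hp => by rw [hfcard p hp]]
        simp [Finset.card_product]
    _ ≤ _ := Finset.sum_le_sum_of_subset_of_nonneg hsub fun R _ _ =>
        mul_nonneg (pow_nonneg hq0 _) (pow_nonneg (by linarith) _)

/-- Every one of the intervals `[b * ℓ, (b + 1) * ℓ)` inside `[0, n)`, where `ℓ = m * (4 * Q)`,
contains a block in which `R` is a spread pair for `ζ`. -/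
def HasSpreadPairs (n Q m : ℕ) (t : ℝ) (ζ : ℂ) (R : Finset ℕ) : Prop :=
  ∀ b, (b + 1) * (m * (4 * Q)) ≤ n → ∃ i < m,
    IsSpreadPair ζ t
      (R ∩ Ico (b * (m * (4 * Q)) + i * (4 * Q)) (b * (m * (4 * Q)) + i * (4 * Q) + 4 * Q))

/-- Union bound over the points of `Z` and at most `n` intervals. In one interval all `m`
independent blocks must fail, and the factor `n + 1` is the cost of fixing the cardinality. -/
theorem card_not_hasSpreadPairs_le {n k Q m : ℕ} (hkn : k < n) {t : ℝ} (ht0 : 0 < t)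
    (ht : t ≤ 1 / 4) (hm : 0 < m) (hqQ : 1 / 16 ≤ (k / n : ℝ) * Q)
    (hqQ' : (k / n : ℝ) * Q ≤ 1 / 8) (Z : Finset ℂ)
    (hZ : ∀ ζ ∈ Z, ‖ζ‖ = 1 ∧ 2 * t / Q ≤ ‖ζ - 1‖) (P : Finset ℕ → Prop) [DecidablePred P]
    (hP : ∀ R, P R → ∃ ζ ∈ Z, ¬ HasSpreadPairs n Q m t ζ R) :
    (#{R ∈ powersetCard k (range n) | P R} : ℝ) ≤
      #Z * n * ((n + 1) * n.choose k * (1 - 1 / 1024) ^ m) := by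
  classical
  have hn : (0 : ℝ) < n := by exact_mod_cast (by omega : 0 < n)
  have hq0 : 0 ≤ (k / n : ℝ) := by positivity
  have hq1 : (k / n : ℝ) ≤ 1 := by rw [div_le_one hn]; exact_mod_cast hkn.le
  have hQ : 0 < Q := by
    rcases Nat.eq_zero_or_pos Q with rfl | h
    · norm_num at hqQ
    · exact h
  set ℓ := m * (4 * Q) with hℓ
  have hℓ1 : 1 ≤ ℓ := Nat.mul_pos hm (by omega)
  let bad : ℂ × ℕ → Finset ℕ → Prop := fun p R => (p.2 + 1) * ℓ ≤ n ∧ ∀ i < m,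
    ¬ IsSpreadPair p.1 t (R ∩ Ico (p.2 * ℓ + i * (4 * Q)) (p.2 * ℓ + i * (4 * Q) + 4 * Q))
  have hsub : ({R ∈ powersetCard k (range n) | P R} : Finset (Finset ℕ)) ⊆
      (Z ×ˢ range n).biUnion fun p => {R ∈ powersetCard k (range n) | bad p R} := by
    intro R hR
    rw [Finset.mem_filter] at hR
    obtain ⟨ζ, hζ, hbad⟩ := hP R hR.2
    simp only [HasSpreadPairs, not_forall, not_exists, not_and] at hbad
    obtain ⟨b, hb, hbad⟩ := hbad
    refine Finset.mem_biUnion.2 ⟨(ζ, b), Finset.mem_product.2 ⟨hζ, Finset.mem_range.2 ?_⟩,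
      Finset.mem_filter.2 ⟨hR.1, hb, hbad⟩⟩
    have : (b + 1) * 1 ≤ n := (Nat.mul_le_mul_left _ hℓ1).trans hb
    simp only
    omega
  have hone : ∀ p ∈ Z ×ˢ range n, (#{R ∈ powersetCard k (range n) | bad p R} : ℝ) ≤
      (n + 1) * n.choose k * (1 - 1 / 1024) ^ m := by
    rintro ⟨ζ, b⟩ hp
    have hζ := hZ ζ (Finset.mem_product.1 hp).1
    by_cases hb : (b + 1) * ℓ ≤ n
    · refine (card_filter_powersetCard_le hkn (bad (ζ, b))).trans
        (mul_le_mul_of_nonneg_left ?_ (by positivity))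
      have hU : Ico (b * ℓ) (b * ℓ + m * (4 * Q)) ⊆ range n := by
        intro x hx
        rw [Finset.mem_Ico] at hx
        rw [Finset.mem_range]
        rw [add_mul] at hb
        omega
      have hblock := bernoulliMass_blocks_le hq0 hq1 (4 * Q) (fun S => ¬ IsSpreadPair ζ t S)
        (x := 1 - 1 / 1024) (by norm_num) (fun a => by
          rw [bernoulliMass_not]
          linarith [bernoulliMass_isSpreadPair_ge hζ.1 ht0 ht hζ.2 hqQ hqQ' a]) (b * ℓ) m
      refine le_trans (le_of_eq ?_) hblock
      rw [← bernoulliMass_inter (k / n : ℝ) hU]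
      refine bernoulliMass_congr fun R _ => ?_
      simp only [bad, hb, true_and]
      refine forall₂_congr fun i hi => ?_
      have h1 : (i + 1) * (4 * Q) ≤ m * (4 * Q) := Nat.mul_le_mul_right _ hi
      have h2 : Ico (b * ℓ + i * (4 * Q)) (b * ℓ + i * (4 * Q) + 4 * Q) ⊆
          Ico (b * ℓ) (b * ℓ + m * (4 * Q)) :=
        Finset.Ico_subset_Ico (by omega) (by linarith)
      rw [Finset.inter_assoc, Finset.inter_eq_right.2 h2]
    · have : ({R ∈ powersetCard k (range n) | bad (ζ, b) R} : Finset (Finset ℕ)) = ∅ :=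
        Finset.filter_eq_empty_iff.2 fun R _ h => hb h.1
      rw [this]
      simp only [Finset.card_empty, Nat.cast_zero]
      exact mul_nonneg (by positivity) (pow_nonneg (by norm_num) _)
  calc (#{R ∈ powersetCard k (range n) | P R} : ℝ)
      ≤ ∑ p ∈ Z ×ˢ range n, (#{R ∈ powersetCard k (range n) | bad p R} : ℝ) := by
        exact_mod_cast (Finset.card_le_card hsub).trans Finset.card_biUnion_le
    _ ≤ #(Z ×ˢ range n) • ((n + 1) * n.choose k * (1 - 1 / 1024 : ℝ) ^ m) :=
        Finset.sum_le_card_nsmul _ _ _ hone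
    _ = _ := by rw [Finset.card_product, card_range, nsmul_eq_mul]; push_cast; ring

end GoodPairs

/-! ### Arcs of the cycle and the reduction of the eigenvector equation to `A`. -/

theorem val_iterate_finRotate {n : ℕ} (u : Fin n) (j : ℕ) :
    ((finRotate n)^[j] u).val = (u.val + j) % n := by
  cases n with
  | zero => exact u.elim0
  | succ n =>
    induction j with
    | zero => simp [Nat.mod_eq_of_lt u.isLt]
    | succ j ih =>
      rw [Function.iterate_succ_apply', finRotate_apply, Fin.val_add, ih]
      simp [← add_assoc]

theorem iterate_finRotate_symm_eq {n : ℕ} {u r : Fin n} {j : ℕ} (h : (r.val + j) % n = u.val) :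
    (finRotate n).symm^[j] u = r := by
  have h1 : (finRotate n)^[j] r = u := Fin.ext ((val_iterate_finRotate r j).trans h)
  rw [← h1]
  exact Function.LeftInverse.iterate (finRotate n).symm_apply_apply j r

namespace CycleConfig

variable {n k : ℕ} (ω : CycleConfig n k)

theorem label_injective {u v : Fin n} (hu : u ∈ ω.removed) (hv : v ∈ ω.removed)
    (h : ω.label u hu = ω.label v hv) : u = v := by
  have : NeZero n := ⟨fun h0 => by subst h0; exact u.elim0⟩
  have key : ∀ {a b : Fin n} (ha : a ∈ ω.removed) (hb : b ∈ ω.removed),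
      a - ω.first < b - ω.first → ω.label a ha < ω.label b hb := by
    intro a b ha hb hab
    refine Finset.card_lt_card ?_
    rw [Finset.ssubset_iff_of_subset]
    · refine ⟨a, ?_, ?_⟩ <;> simp [ha, hab]
    · intro c hc
      rw [Finset.mem_filter] at hc ⊢
      exact ⟨hc.1, hc.2.trans hab⟩
  rcases lt_trichotomy (u - ω.first) (v - ω.first) with h1 | h1 | h1
  · exact absurd h (key hu hv h1).ne
  · exact sub_left_injective h1
  · exact absurd h (key hv hu h1).ne'

/-- The labels enumerate the tails of the removed edges. -/
noncomputable def labelEquiv : {e // e ∈ ω.removed} ≃ Fin k :=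
  Equiv.ofBijective (fun e => ω.label e.1 e.2) <| by
    rw [Fintype.bijective_iff_injective_and_card]
    exact ⟨fun a b h => Subtype.ext (ω.label_injective a.2 b.2 h), by simp [ω.card_removed]⟩

/-- The tail of the removed edge with a given label. -/
noncomputable def tail (i : Fin k) : Fin n := (ω.labelEquiv.symm i).1

theorem tail_mem (i : Fin k) : ω.tail i ∈ ω.removed := (ω.labelEquiv.symm i).2

theorem label_tail (i : Fin k) : ω.label (ω.tail i) (ω.tail_mem i) = i :=
  ω.labelEquiv.apply_symm_apply i

theorem tail_label {e : Fin n} (he : e ∈ ω.removed) : ω.tail (ω.label e he) = e :=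
  congrArg Subtype.val (ω.labelEquiv.symm_apply_apply ⟨e, he⟩)

theorem tail_injective : Function.Injective ω.tail := fun _ _ h =>
  ω.labelEquiv.symm.injective (Subtype.ext h)

theorem sum_dite_removed {E : Type*} [AddCommMonoid E] (f : Fin n → E) (g : Fin k → E)
    (hf : ∀ u, u ∉ ω.removed → f u = 0) (hg : ∀ i, f (ω.tail i) = g i) :
    ∑ u, f u = ∑ i, g i := by
  rw [← Finset.sum_subset (Finset.subset_univ ω.removed) fun u _ hu => hf u hu,
    ← Finset.sum_coe_sort, ← ω.labelEquiv.symm.sum_comp]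
  exact Finset.sum_congr rfl fun i _ => hg i

variable (A : Matrix (Fin k) (Fin k) ℝ)

theorem transition_apply_of_notMem {u : Fin n} (hu : u ∉ ω.removed) (w : Fin n) :
    ω.transition A u w = if w = finRotate n u then 1 else 0 := by
  simp [transition, hu]

theorem transition_tail_head (i j : Fin k) :
    ω.transition A (ω.tail j) (finRotate n (ω.tail i)) = A i j := by
  simp [-finRotate_apply, transition, ω.tail_mem, ω.label_tail]

theorem transition_tail_rotate_of_notMem (j : Fin k) {u : Fin n} (hu : u ∉ ω.removed) :
    ω.transition A (ω.tail j) (finRotate n u) = 0 := by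
  simp [-finRotate_apply, transition, ω.tail_mem, hu]

theorem transition_mem_doublyStochastic {A : Matrix (Fin k) (Fin k) ℝ}
    (hA : A ∈ doublyStochastic ℝ (Fin k)) :
    ω.transition A ∈ doublyStochastic ℝ (Fin n) := by
  rw [mem_doublyStochastic_iff_sum]
  refine ⟨fun u w => ?_, fun u => ?_, fun w => ?_⟩
  · unfold transition
    split_ifs
    · exact nonneg_of_mem_doublyStochastic hA
    all_goals norm_num
  · by_cases hu : u ∈ ω.removed
    · rw [← ω.tail_label hu, ← Equiv.sum_comp (finRotate n),
        ω.sum_dite_removed _ _ (fun v hv => ω.transition_tail_rotate_of_notMem A _ hv)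
        (fun i => ω.transition_tail_head A i _), sum_col_of_mem_doublyStochastic hA]
    · simp [ω.transition_apply_of_notMem A hu]
  · obtain ⟨e, rfl⟩ := (finRotate n).surjective w
    by_cases he : e ∈ ω.removed
    · rw [← ω.tail_label he]
      rw [ω.sum_dite_removed _ (fun i => A (ω.label e he) i) ?_
        (fun i => ω.transition_tail_head A _ i), sum_row_of_mem_doublyStochastic hA]
      intro u hu
      rw [ω.transition_apply_of_notMem A hu, if_neg]
      rw [(finRotate n).injective.eq_iff, ω.tail_label he]
      rintro rfl
      exact hu he
    · have : ∀ u, ω.transition A u (finRotate n e) = if u = e then 1 else 0 := by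
        intro u
        by_cases hu : u ∈ ω.removed
        · rw [if_neg (by rintro rfl; exact he hu)]
          have := ω.transition_tail_rotate_of_notMem A (ω.label u hu) he
          rwa [ω.tail_label hu] at this
        · rw [ω.transition_apply_of_notMem A hu]
          simp [eq_comm]
      simp [-finRotate_apply, this]

/-- The number of steps of the cycle from the end of the last removed edge before `u` to `u`. -/
noncomputable def offset (u : Fin n) : ℕ :=
  sInf {i | (finRotate n).symm^[i + 1] u ∈ ω.removed}

/-- The tail of the last removed edge before `u`. -/
noncomputable def prevTail (u : Fin n) : Fin n := (finRotate n).symm^[ω.offset u + 1] u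

/-- Among any `M` consecutive edges of the cycle there is a removed one. -/
def GapsLE (M : ℕ) : Prop := ∀ u, ∃ i < M, (finRotate n).symm^[i + 1] u ∈ ω.removed

variable {ω} {M : ℕ}

theorem GapsLE.prevTail_mem (h : ω.GapsLE M) (u : Fin n) : ω.prevTail u ∈ ω.removed := by
  obtain ⟨i, -, hi⟩ := h u
  exact Nat.sInf_mem (s := {i | (finRotate n).symm^[i + 1] u ∈ ω.removed}) ⟨i, hi⟩

theorem GapsLE.offset_lt (h : ω.GapsLE M) (u : Fin n) : ω.offset u < M := by
  obtain ⟨i, hiM, hi⟩ := h u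
  exact (Nat.sInf_le (s := {i | (finRotate n).symm^[i + 1] u ∈ ω.removed}) hi).trans_lt hiM

theorem iterate_notMem_of_lt_offset {u : Fin n} {i : ℕ} (hi : i < ω.offset u) :
    (finRotate n).symm^[i + 1] u ∉ ω.removed :=
  Nat.notMem_of_lt_sInf hi

theorem iterate_prevTail (ω : CycleConfig n k) (u : Fin n) :
    (finRotate n)^[ω.offset u + 1] (ω.prevTail u) = u :=
  Function.LeftInverse.iterate (finRotate n).apply_symm_apply (ω.offset u + 1) u

/-- If two removed tails had the same predecessor, walking back from the farther one would meet the
nearer one first. -/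
theorem prevTail_injOn {e e' : Fin n} (he : e ∈ ω.removed) (he' : e' ∈ ω.removed)
    (h : ω.prevTail e = ω.prevTail e') : e = e' := by
  have key : ∀ {a b : Fin n}, a ∈ ω.removed → ω.prevTail a = ω.prevTail b →
      ¬ ω.offset a < ω.offset b := by
    intro a b ha hab hlt
    refine iterate_notMem_of_lt_offset (ω := ω) (u := b) (i := ω.offset b - ω.offset a - 1) (by omega) ?_
    have h1 := ω.iterate_prevTail b
    rw [← hab,
      show ω.offset b + 1 = (ω.offset b - ω.offset a - 1 + 1) + (ω.offset a + 1) by omega,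
      Function.iterate_add_apply, ω.iterate_prevTail a] at h1
    convert ha
    generalize ω.offset b - ω.offset a - 1 + 1 = j at h1
    rw [← h1]
    exact Function.LeftInverse.iterate (finRotate n).symm_apply_apply j a
  have h1 : ω.offset e = ω.offset e' :=
    le_antisymm (not_lt.1 (key he' h.symm)) (not_lt.1 (key he h))
  rw [← ω.iterate_prevTail e, ← ω.iterate_prevTail e', h, h1]

/-- Reads a gap off the values in `ℕ` when the arc does not cross the vertex `0`. -/
theorem offset_add_one_eq {u : Fin n} {d : ℕ} (hd : 1 ≤ d) (hdu : d ≤ u.val)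
    (hmem : ∃ r ∈ ω.removed, r.val = u.val - d)
    (hno : ∀ r ∈ ω.removed, u.val - d < r.val → u.val ≤ r.val) : ω.offset u + 1 = d := by
  have hmod : ∀ j ≤ u.val, ∃ r : Fin n, r.val = u.val - j ∧
      (finRotate n).symm^[j] u = r := fun j hj =>
    ⟨⟨u.val - j, by omega⟩, rfl, iterate_finRotate_symm_eq (by
      simp only [Nat.sub_add_cancel hj]
      exact Nat.mod_eq_of_lt u.isLt)⟩
  suffices h : ω.offset u = d - 1 by omega
  refine le_antisymm (Nat.sInf_le ?_) (le_csInf ⟨d - 1, ?_⟩ ?_)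
  iterate 2
    obtain ⟨r, hr, hrd⟩ := hmem
    obtain ⟨r', hr', hrd'⟩ := hmod d hdu
    simp only [Set.mem_ofPred_eq]
    rw [Nat.sub_add_cancel hd, hrd', show r' = r from Fin.ext (by omega)]
    exact hr
  intro i hi
  by_contra! hlt
  obtain ⟨r', hr', hrd'⟩ := hmod (i + 1) (by omega)
  simp only [Set.mem_ofPred_eq, hrd'] at hi
  have := hno r' hi (by omega)
  omega

section Eigenvector

open Matrix

variable {A : Matrix (Fin k) (Fin k) ℝ} {μ : ℂ} {v : Fin n → ℂ}

theorem apply_finRotate_of_notMem (hv : (ω.transition A).map Complex.ofReal *ᵥ v = μ • v)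
    {u : Fin n} (hu : u ∉ ω.removed) : v (finRotate n u) = μ * v u := by
  have := congrFun hv u
  simp only [Matrix.mulVec, dotProduct, Matrix.map_apply, ω.transition_apply_of_notMem A hu,
    Pi.smul_apply, smul_eq_mul] at this
  rw [← this, Finset.sum_eq_single (finRotate n u)]
  · simp
  · intro w _ hw
    simp [-finRotate_apply, hw]
  · simp

theorem eigenvector_apply (hv : (ω.transition A).map Complex.ofReal *ᵥ v = μ • v) (u : Fin n) :
    v u = μ ^ ω.offset u * v (finRotate n (ω.prevTail u)) := by
  have key : ∀ i ≤ ω.offset u, v u = μ ^ i * v ((finRotate n).symm^[i] u) := by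
    intro i
    induction i with
    | zero => simp
    | succ i ih =>
      intro hi
      have h1 := apply_finRotate_of_notMem hv (iterate_notMem_of_lt_offset (u := u) (i := i) hi)
      have h2 : finRotate n ((finRotate n).symm^[i + 1] u) = (finRotate n).symm^[i] u := by
        rw [Function.iterate_succ_apply', Equiv.apply_symm_apply]
      rw [h2] at h1
      rw [ih (by omega), h1, pow_succ, mul_assoc]
  rw [key _ le_rfl, prevTail, Function.iterate_succ_apply', Equiv.apply_symm_apply]

/-- The label of the removed edge preceding the one with label `i`. -/
noncomputable def prevLabel (h : ω.GapsLE M) (i : Fin k) : Fin k :=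
  ω.label (ω.prevTail (ω.tail i)) (h.prevTail_mem _)

theorem prevLabel_injective (h : ω.GapsLE M) : Function.Injective (prevLabel h) := by
  intro i j hij
  exact ω.tail_injective (prevTail_injOn (ω.tail_mem i) (ω.tail_mem j)
    (ω.label_injective _ _ hij))

/-- The left side is the row of the transition matrix at the tail `i`, by symmetry of `A`. The right
side is `μ * v` at that tail, carried back along the kept arc to the preceding head; the exponent is
the full gap length. -/
theorem mulVec_heads (hA : A.IsSymm) (h : ω.GapsLE M)
    (hv : (ω.transition A).map Complex.ofReal *ᵥ v = μ • v) (i : Fin k) :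
    (A.map Complex.ofReal *ᵥ fun j => v (finRotate n (ω.tail j))) i =
      μ ^ (ω.offset (ω.tail i) + 1) * v (finRotate n (ω.tail (prevLabel h i))) := by
  have h1 := congrFun hv (ω.tail i)
  rw [Pi.smul_apply, eigenvector_apply hv (ω.tail i), smul_eq_mul, ← mul_assoc,
    ← pow_succ'] at h1
  rw [prevLabel, tail_label, ← h1]
  simp only [Matrix.mulVec, dotProduct, Matrix.map_apply]
  rw [← Equiv.sum_comp (finRotate n)]
  refine (ω.sum_dite_removed _ _ (fun u hu => ?_) fun j => ?_).symm
  · rw [ω.transition_tail_rotate_of_notMem A i hu]; simp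
  · rw [ω.transition_tail_head, hA.apply]

end Eigenvector

end CycleConfig

/-! ### Vectors that `A` maps to a twisted permutation of themselves. -/

section TwistedFixedVectors

open Matrix

variable {ι : Type} [Fintype ι]

theorem sum_norm_sq_const_add {w : ι → ℂ} (hw : ∑ i, w i = 0) (m : ℂ) :
    ∑ i, ‖m + w i‖ ^ 2 = Fintype.card ι * ‖m‖ ^ 2 + ∑ i, ‖w i‖ ^ 2 := by
  have h1 : ∀ i, ‖m + w i‖ ^ 2 = ‖m‖ ^ 2 + ‖w i‖ ^ 2 + 2 * (m * (starRingEnd ℂ) (w i)).re := by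
    intro i
    simp only [← Complex.normSq_eq_norm_sq]
    exact Complex.normSq_add m (w i)
  have h2 : ∑ i, (m * (starRingEnd ℂ) (w i)).re = 0 := by
    rw [← Complex.re_sum, ← Finset.mul_sum, ← map_sum, hw]
    simp
  simp only [h1, Finset.sum_add_distrib, ← Finset.mul_sum, h2]
  simp

variable [DecidableEq ι] {A : Matrix ι ι ℝ} {δ : ℝ} {μ m : ℂ} {L : ι → ℕ} {π : ι → ι} {w : ι → ℂ}

theorem mulVec_const_add (hA : A ∈ doublyStochastic ℝ ι) (i : ι) :
    (A.map Complex.ofReal *ᵥ fun j => m + w j) i = m + (A.map Complex.ofReal *ᵥ w) i := by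
  have h : (fun j => m + w j) = (fun _ => m) + w := rfl
  rw [h, Matrix.mulVec_add, mulVec_map_ofReal_const hA]
  rfl

/-- A vector on which `A` acts by permuting coordinates and multiplying them by numbers of modulus
at least `1 - ε` is close to a constant vector. -/
theorem gap_mul_sum_norm_sq_le (hsymm : A.IsSymm) (hA : A ∈ doublyStochastic ℝ ι)
    (hirr : A.IsIrreducible) (hδ : 0 ≤ δ) (hgap : δ ≤ spectralGap A)
    (hπ : Function.Injective π) (hw : ∑ i, w i = 0)
    (heq : ∀ i, (A.map Complex.ofReal *ᵥ fun j => m + w j) i = μ ^ L i * (m + w (π i)))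
    {ε : ℝ} (hε1 : ε ≤ 1) (hμ : ∀ i, 1 - ε ≤ ‖μ‖ ^ L i) :
    δ * ∑ i, ‖w i‖ ^ 2 ≤ 2 * ε * (Fintype.card ι * ‖m‖ ^ 2 + ∑ i, ‖w i‖ ^ 2) := by
  have h1 : ∑ i, ‖(A.map Complex.ofReal *ᵥ fun j => m + w j) i‖ ^ 2 ≤
      Fintype.card ι * ‖m‖ ^ 2 + (1 - δ) * ∑ i, ‖w i‖ ^ 2 := by
    simp only [mulVec_const_add hA]
    rw [sum_norm_sq_const_add (by rw [sum_mulVec_map_ofReal hA, hw])]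
    linarith [sum_norm_sq_mulVec_le hsymm hA hirr hδ hgap hw]
  -- The twisted permutation shrinks squared norms by at most `(1 - ε) ^ 2 ≥ 1 - 2 * ε`, whereas by
  -- `h1` the matrix shrinks the part `w` by `1 - δ`.
  have h2 : (1 - 2 * ε) * ∑ i, ‖m + w i‖ ^ 2 ≤
      ∑ i, ‖(A.map Complex.ofReal *ᵥ fun j => m + w j) i‖ ^ 2 := by
    have hbij : ∑ i, ‖m + w (π i)‖ ^ 2 = ∑ i, ‖m + w i‖ ^ 2 :=
      (Finite.injective_iff_bijective.1 hπ).sum_comp fun i => ‖m + w i‖ ^ 2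
    rw [← hbij, Finset.mul_sum]
    refine Finset.sum_le_sum fun i _ => ?_
    rw [heq, norm_mul, mul_pow, norm_pow]
    refine mul_le_mul_of_nonneg_right ?_ (sq_nonneg _)
    nlinarith [pow_le_pow_left₀ (sub_nonneg.2 hε1) (hμ i) 2, sq_nonneg ε]
  rw [sum_norm_sq_const_add hw] at h2
  linarith

/-- As `A` fixes constants, `m * (μ ^ L i - 1) = (A w) i - μ ^ L i * w (π i)`, and both terms on the
right have norm at most that of `w`. -/
theorem norm_sq_mul_sum_norm_pow_sub_one_le (hsymm : A.IsSymm) (hA : A ∈ doublyStochastic ℝ ι)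
    (hirr : A.IsIrreducible) (hδ : 0 ≤ δ) (hgap : δ ≤ spectralGap A)
    (hπ : Function.Injective π) (hw : ∑ i, w i = 0) (hμ : ‖μ‖ ≤ 1)
    (heq : ∀ i, (A.map Complex.ofReal *ᵥ fun j => m + w j) i = μ ^ L i * (m + w (π i))) :
    ‖m‖ ^ 2 * ∑ i, ‖μ ^ L i - 1‖ ^ 2 ≤ 4 * ∑ i, ‖w i‖ ^ 2 := by
  have hbij : ∑ i, ‖w (π i)‖ ^ 2 = ∑ i, ‖w i‖ ^ 2 :=
    (Finite.injective_iff_bijective.1 hπ).sum_comp fun i => ‖w i‖ ^ 2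
  have h1 : ∀ i, ‖m‖ ^ 2 * ‖μ ^ L i - 1‖ ^ 2 ≤
      2 * ‖(A.map Complex.ofReal *ᵥ w) i‖ ^ 2 + 2 * ‖w (π i)‖ ^ 2 := by
    intro i
    have h2 : m * (μ ^ L i - 1) = (A.map Complex.ofReal *ᵥ w) i - μ ^ L i * w (π i) := by
      have := heq i
      rw [mulVec_const_add hA] at this
      linear_combination -this
    rw [← mul_pow, ← norm_mul, h2]
    have h3 : ‖μ ^ L i * w (π i)‖ ≤ ‖w (π i)‖ := by
      rw [norm_mul, norm_pow]
      exact mul_le_of_le_one_left (norm_nonneg _) (pow_le_one₀ (norm_nonneg _) hμ)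
    have h4 := norm_sub_le ((A.map Complex.ofReal *ᵥ w) i) (μ ^ L i * w (π i))
    have h5 := pow_le_pow_left₀ (norm_nonneg _) (h4.trans (add_le_add_right h3 _)) 2
    nlinarith [sq_nonneg (‖(A.map Complex.ofReal *ᵥ w) i‖ - ‖w (π i)‖)]
  have h6 := sum_norm_sq_mulVec_le hsymm hA hirr hδ hgap hw
  have h7 : 0 ≤ ∑ i, ‖w i‖ ^ 2 := Finset.sum_nonneg fun i _ => sq_nonneg _
  rw [Finset.mul_sum]
  refine (Finset.sum_le_sum fun i _ => h1 i).trans ?_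
  rw [Finset.sum_add_distrib, ← Finset.mul_sum, ← Finset.mul_sum, hbij]
  nlinarith

end TwistedFixedVectors

theorem norm_pow_sub_one_le {μ : ℂ} (hμ : ‖μ‖ ≤ 1) (i : ℕ) : ‖μ ^ i - 1‖ ≤ i * ‖μ - 1‖ := by
  rw [← mul_geom_sum, norm_mul, mul_comm]
  refine mul_le_mul_of_nonneg_right ?_ (norm_nonneg _)
  refine (norm_sum_le _ _).trans ((Finset.sum_le_card_nsmul _ _ 1 fun j _ => ?_).trans (by simp))
  rw [norm_pow]
  exact pow_le_one₀ (norm_nonneg _) hμ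

theorem exists_const_add {ι : Type} [Fintype ι] [Nonempty ι] (y : ι → ℂ) :
    ∃ (m : ℂ) (w : ι → ℂ), ∑ i, w i = 0 ∧ y = fun i => m + w i := by
  refine ⟨(∑ i, y i) / Fintype.card ι, fun i => y i - (∑ i, y i) / Fintype.card ι, ?_, ?_⟩
  · rw [Finset.sum_sub_distrib]
    have : (Fintype.card ι : ℂ) ≠ 0 := by exact_mod_cast Fintype.card_ne_zero
    simp
    field_simp
    ring
  · funext i; ring

/-! ### Exclusion of eigenvalues for a given configuration. -/

namespace CycleConfig

open Matrix

variable {n k : ℕ} {ω : CycleConfig n k} {M : ℕ} {A : Matrix (Fin k) (Fin k) ℝ}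

/-- A vertex is determined by its preceding removed edge and its offset, so each label is counted at
most `M` times. -/
theorem GapsLE.sum_prevTail_le (h : ω.GapsLE M) (f : Fin k → ℝ) (hf : ∀ i, 0 ≤ f i) :
    ∑ u, f (ω.label (ω.prevTail u) (h.prevTail_mem u)) ≤ M * ∑ i, f i := by
  let g : Fin n → Fin k × ℕ := fun u => (ω.label (ω.prevTail u) (h.prevTail_mem u), ω.offset u)
  have hg : Function.Injective g := by
    intro u u' he
    have h1 := ω.label_injective (h.prevTail_mem u) (h.prevTail_mem u') (congrArg Prod.fst he)
    have h2 : ω.offset u = ω.offset u' := congrArg Prod.snd he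
    rw [← ω.iterate_prevTail u, ← ω.iterate_prevTail u', h1, h2]
  calc ∑ u, f (g u).1 = ∑ p ∈ Finset.univ.image g, f p.1 :=
        (Finset.sum_image (f := fun p : Fin k × ℕ => f p.1) fun _ _ _ _ he => hg he).symm
    _ ≤ ∑ p ∈ Finset.univ ×ˢ Finset.range M, f p.1 := by
        refine Finset.sum_le_sum_of_subset_of_nonneg ?_ fun p _ _ => hf _
        intro p hp
        obtain ⟨u, -, rfl⟩ := Finset.mem_image.1 hp
        exact Finset.mem_product.2 ⟨Finset.mem_univ _, Finset.mem_range.2 (h.offset_lt u)⟩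
    _ = M * ∑ i, f i := by
        rw [Finset.sum_product_right]
        simp

/-- A fixed vector is the case `μ = 1`, where there is no loss: `ε = 0` forces `w = 0`, and then `v`
is constant. -/
theorem transition_isIrreducible (hsymm : A.IsSymm) (hA : A ∈ doublyStochastic ℝ (Fin k))
    (hirr : A.IsIrreducible) (hgap : 0 < spectralGap A) (h : ω.GapsLE M) :
    (ω.transition A).IsIrreducible := by
  have : Nonempty (Fin k) := ⟨ω.label _ ω.first_mem⟩
  refine irreducible_of_fixed_eq (ω.transition_mem_doublyStochastic hA) fun v hv => ?_
  have hvc : (ω.transition A).map Complex.ofReal *ᵥ (fun u => (v u : ℂ)) =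
      (1 : ℂ) • fun u => (v u : ℂ) := by
    rw [one_smul]
    funext u
    apply Complex.ext
    · rw [mulVec_map_ofReal_re]; simpa using congrFun hv u
    · rw [mulVec_map_ofReal_im]; simp [Matrix.mulVec, dotProduct]
  obtain ⟨m, w, hw, hy⟩ := exists_const_add fun j => ((v (finRotate n (ω.tail j)) : ℝ) : ℂ)
  have heq := mulVec_heads hsymm h hvc
  have hyi : ∀ j, ((v (finRotate n (ω.tail j)) : ℝ) : ℂ) = m + w j := congrFun hy
  simp only [hyi] at heq
  have h1 := gap_mul_sum_norm_sq_le hsymm hA hirr hgap.le le_rfl (prevLabel_injective h) hw heq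
    (ε := 0) zero_le_one (by simp)
  have h0 : ∑ i, ‖w i‖ ^ 2 = 0 := by
    refine le_antisymm ?_ (Finset.sum_nonneg fun i _ => sq_nonneg _)
    by_contra! hpos
    nlinarith [mul_pos hgap hpos]
  have hw0 : ∀ i, w i = 0 := fun i => by
    simpa using (Finset.sum_eq_zero_iff_of_nonneg fun i _ => sq_nonneg ‖w i‖).1 h0 i
      (Finset.mem_univ _)
  have hconst : ∀ u, (v u : ℂ) = m := by
    intro u
    have h2 := eigenvector_apply hvc u
    have h3 := hyi (ω.label _ (h.prevTail_mem u))
    rw [tail_label, hw0, add_zero] at h3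
    simpa only [one_pow, one_mul, h3] using h2
  intro i j
  exact_mod_cast (hconst i).trans (hconst j).symm

/-- Eigenvalues other than `1` and close to the unit circle are excluded if no gap is long and if
the numbers `μ ^ L`, where `L` ranges over the gaps, are not all close to `1`. -/
theorem false_of_eigenvector (hsymm : A.IsSymm) (hA : A ∈ doublyStochastic ℝ (Fin k))
    (hirr : A.IsIrreducible) {δ : ℝ} (hδ : 0 < δ) (hgap : δ ≤ spectralGap A)
    (h : ω.GapsLE M) {μ : ℂ} (hμ1 : μ ≠ 1) {v : Fin n → ℂ} (hv0 : v ≠ 0)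
    (hv : (ω.transition A).map Complex.ofReal *ᵥ v = μ • v)
    {ε : ℝ} (hε1 : ε ≤ 1) (hεδ : 4 * ε ≤ δ) (hμε : 1 - ε ≤ ‖μ‖ ^ M)
    (hsmall : 16 * ε * (M * k : ℝ) ^ 2 < δ * (n : ℝ) ^ 2)
    (hlarge : 1 / 2 < M * ‖μ - 1‖ →
      16 * ε * k < δ * ∑ i, ‖μ ^ (ω.offset (ω.tail i) + 1) - 1‖ ^ 2) : False := by
  have : Nonempty (Fin k) := ⟨ω.label _ ω.first_mem⟩
  have hH := ω.transition_mem_doublyStochastic hA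
  have hμ := norm_eigenvalue_le_one hH hv0 hv
  have hpowM : ∀ j ≤ M, 1 - ε ≤ ‖μ‖ ^ j := fun j hj =>
    hμε.trans (pow_le_pow_of_le_one (norm_nonneg _) hμ hj)
  have hε0 : 0 ≤ ε := by linarith [pow_le_one₀ (norm_nonneg μ) hμ (n := M)]
  obtain ⟨m, w, hw, hy⟩ := exists_const_add fun j => v (finRotate n (ω.tail j))
  have heq := mulVec_heads hsymm h hv
  have hyi : ∀ j, v (finRotate n (ω.tail j)) = m + w j := congrFun hy
  simp only [hyi] at heq
  have h1 := gap_mul_sum_norm_sq_le hsymm hA hirr hδ.le hgap (prevLabel_injective h) hw heq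
    hε1 (fun i => hpowM _ (h.offset_lt _))
  have h2 := norm_sq_mul_sum_norm_pow_sub_one_le hsymm hA hirr hδ.le hgap
    (prevLabel_injective h) hw hμ heq
  rw [Fintype.card_fin] at h1
  set W := ∑ i, ‖w i‖ ^ 2
  have hW0 : 0 ≤ W := Finset.sum_nonneg fun i _ => sq_nonneg _
  -- The assumption `4 * ε ≤ δ` absorbs the term `2 * ε * W`.
  have h3 : δ * W ≤ 4 * ε * (k * ‖m‖ ^ 2) := by nlinarith
  have hvu : ∀ u, v u =
      μ ^ ω.offset u * (m + w (ω.label (ω.prevTail u) (h.prevTail_mem u))) := by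
    intro u
    rw [← hyi, tail_label]
    exact eigenvector_apply hv u
  have hm : 0 < ‖m‖ ^ 2 := by
    by_contra! hneg
    have hm0 : m = 0 := by
      have : ‖m‖ ^ 2 = 0 := le_antisymm hneg (sq_nonneg _)
      simpa using this
    have hW : W = 0 := by
      refine le_antisymm ?_ hW0
      rw [hm0] at h3
      simp at h3
      by_contra! hpos
      exact absurd h3 (not_le.2 (mul_pos hδ hpos))
    have hw0 : ∀ i, w i = 0 := fun i => by
      simpa using (Finset.sum_eq_zero_iff_of_nonneg fun i _ => sq_nonneg ‖w i‖).1 hW i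
        (Finset.mem_univ _)
    exact hv0 (funext fun u => by rw [hvu, hm0, hw0]; simp)
  -- Far from `1`, `h2` and `h3` contradict `hlarge`. Near `1`, every `μ ^ offset` is within `1 / 2`
  -- of `1`; comparing `v` with `m` and using that `v` has sum zero gives `n * ‖m‖ / 2 ≤ M * ∑ ‖w
  -- i‖`, which contradicts `hsmall`.
  by_cases hcase : 1 / 2 < M * ‖μ - 1‖
  · have h4 := hlarge hcase
    have h5 := mul_lt_mul_of_pos_right h4 hm
    have h6 := mul_le_mul_of_nonneg_left h2 hδ.le
    linarith
  · push Not at hcase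
    have hsum0 : ∑ u, v u = 0 := by
      have h4 := sum_mulVec_map_ofReal hH v
      rw [hv] at h4
      simp only [Pi.smul_apply, smul_eq_mul, ← Finset.mul_sum] at h4
      have h5 : (μ - 1) * ∑ u, v u = 0 := by linear_combination h4
      exact (mul_eq_zero.1 h5).resolve_left (sub_ne_zero.2 hμ1)
    have h4 : ∀ u, ‖m - v u‖ ≤
        ‖w (ω.label (ω.prevTail u) (h.prevTail_mem u))‖ + ‖m‖ / 2 := by
      intro u
      set x := w (ω.label (ω.prevTail u) (h.prevTail_mem u))
      have h5 : m - v u = -(μ ^ ω.offset u * x) - (μ ^ ω.offset u - 1) * m := by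
        rw [hvu u]; ring
      rw [h5]
      refine (norm_sub_le _ _).trans (add_le_add ?_ ?_)
      · rw [norm_neg, norm_mul, norm_pow]
        exact mul_le_of_le_one_left (norm_nonneg _) (pow_le_one₀ (norm_nonneg _) hμ)
      · rw [norm_mul]
        have h6 : ‖μ ^ ω.offset u - 1‖ ≤ 1 / 2 := by
          refine (norm_pow_sub_one_le hμ _).trans (le_trans ?_ hcase)
          have := (h.offset_lt u).le
          gcongr
        nlinarith [norm_nonneg m]
    have h5 : (n : ℝ) * ‖m‖ ≤ M * ∑ i, ‖w i‖ + n * (‖m‖ / 2) := by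
      have h6 : (n : ℂ) * m = ∑ u, (m - v u) := by
        rw [Finset.sum_sub_distrib, hsum0]; simp
      have h7 : (n : ℝ) * ‖m‖ = ‖∑ u, (m - v u)‖ := by
        rw [← h6, norm_mul, Complex.norm_natCast]
      rw [h7]
      refine (norm_sum_le _ _).trans ((Finset.sum_le_sum fun u _ => h4 u).trans ?_)
      rw [Finset.sum_add_distrib]
      refine add_le_add (h.sum_prevTail_le (fun i => ‖w i‖) fun i => norm_nonneg _) ?_
      simp
    have h6 : (∑ i, ‖w i‖) ^ 2 ≤ k * W := by
      have := sq_sum_le_card_mul_sum_sq (s := Finset.univ) (f := fun i => ‖w i‖)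
      simpa using this
    have h7 : ((n : ℝ) * ‖m‖ / 2) ^ 2 ≤ (M * ∑ i, ‖w i‖) ^ 2 :=
      pow_le_pow_left₀ (by positivity) (by linarith) 2
    have h8 : (n : ℝ) ^ 2 * ‖m‖ ^ 2 ≤ 4 * (M : ℝ) ^ 2 * (k * W) := by
      have := mul_le_mul_of_nonneg_left h6 (sq_nonneg (M : ℝ))
      nlinarith
    have h9 := mul_le_mul_of_nonneg_left h8 hδ.le
    have h10 := mul_le_mul_of_nonneg_left h3 (by positivity : (0 : ℝ) ≤ 4 * (M : ℝ) ^ 2 * k)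
    have h11 := mul_lt_mul_of_pos_right hsmall hm
    nlinarith

end CycleConfig

/-! ### Approximation on the unit circle. -/

theorem exists_unit_circle_net (n : ℕ) (hn : 0 < n) :
    ∃ Z : Finset ℂ, Z.card ≤ n + 1 ∧ (∀ ζ ∈ Z, ‖ζ‖ = 1) ∧ (-1 : ℂ) ∈ Z ∧
      ∀ z : ℂ, ‖z‖ = 1 → ∃ ζ ∈ Z, ‖z - ζ‖ ≤ 7 / n := by
  have hn' : (0 : ℝ) < n := by exact_mod_cast hn
  have hpi := Real.pi_pos
  -- Starting at `-π` puts `-1` into the net; the spacing is `2π / n < 7 / n`.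
  let φ : ℕ → ℝ := fun j => 2 * Real.pi * j / n - Real.pi
  let e : ℕ → ℂ := fun j => Complex.exp (φ j * Complex.I)
  refine ⟨(Finset.range (n + 1)).image e, Finset.card_image_le.trans (by simp), ?_, ?_, ?_⟩
  · intro ζ hζ
    obtain ⟨j, -, rfl⟩ := Finset.mem_image.1 hζ
    exact Complex.norm_exp_ofReal_mul_I _
  · refine Finset.mem_image.2 ⟨0, by simp, ?_⟩
    simp [e, φ, Complex.exp_neg]
  · intro z hz
    set θ := Complex.arg z
    have hθ1 := Complex.neg_pi_lt_arg z
    have hθ2 := Complex.arg_le_pi z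
    have hzθ : z = Complex.exp (θ * Complex.I) := by
      have := Complex.norm_mul_exp_arg_mul_I z
      rw [hz] at this
      simpa using this.symm
    set s : ℝ := (θ + Real.pi) * n / (2 * Real.pi) with hs
    have hs0 : 0 ≤ s := by
      have : 0 ≤ θ + Real.pi := by linarith
      positivity
    have hsn : s ≤ n := by
      rw [hs, div_le_iff₀ (by positivity)]
      nlinarith
    have hf1 := Nat.floor_le hs0
    have hf2 := Nat.lt_floor_add_one s
    refine ⟨e ⌊s⌋₊, Finset.mem_image.2 ⟨⌊s⌋₊, Finset.mem_range.2 ?_, rfl⟩, ?_⟩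
    · exact Nat.lt_succ_of_le (Nat.floor_le_of_le hsn)
    · have h1 : z - e ⌊s⌋₊ = e ⌊s⌋₊ *
          (Complex.exp (Complex.I * ((θ - φ ⌊s⌋₊ : ℝ) : ℂ)) - 1) := by
        rw [mul_sub, mul_one, ← Complex.exp_add, hzθ]
        congr 2
        push_cast
        ring
      rw [h1, norm_mul, Complex.norm_exp_ofReal_mul_I, one_mul]
      refine (Real.norm_exp_I_mul_ofReal_sub_one_le).trans ?_
      have h2 : θ - φ ⌊s⌋₊ = 2 * Real.pi / n * (s - ⌊s⌋₊) := by
        simp only [φ, hs]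
        field_simp
        ring
      rw [h2, Real.norm_of_nonneg (mul_nonneg (by positivity) (by linarith))]
      calc 2 * Real.pi / n * (s - ⌊s⌋₊) ≤ 2 * Real.pi / n * 1 := by
            gcongr; linarith
        _ ≤ 7 / n := by
            rw [mul_one]
            gcongr
            linarith [Real.pi_lt_d2]

/-- The radial projection moves `μ ^ L` by `|1 - ‖μ ^ L‖| ≤ ‖μ ^ L - 1‖`. This transfers estimates
on the circle to `μ` itself. -/
theorem norm_div_norm_pow_sub_one_le {μ : ℂ} (hμ : μ ≠ 0) (L : ℕ) :
    ‖(μ / ‖μ‖) ^ L - 1‖ ≤ 2 * ‖μ ^ L - 1‖ := by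
  have h0 : (‖μ‖ : ℂ) ≠ 0 := by exact_mod_cast norm_ne_zero_iff.2 hμ
  set z : ℂ := μ / ‖μ‖
  have hz : ‖z‖ = 1 := by
    rw [norm_div, Complex.norm_real, norm_norm, div_self (norm_ne_zero_iff.2 hμ)]
  have h1 : z ^ L - μ ^ L = z ^ L * ((1 - ‖μ ^ L‖ : ℝ) : ℂ) := by
    have : μ = z * ‖μ‖ := by simp only [z]; field_simp
    nth_rewrite 1 [this]
    rw [mul_pow, norm_pow]
    push_cast
    ring
  have h2 : ‖z ^ L - μ ^ L‖ ≤ ‖μ ^ L - 1‖ := by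
    rw [h1, norm_mul, norm_pow, hz, one_pow, one_mul, Complex.norm_real, norm_sub_rev (μ ^ L)]
    have := abs_norm_sub_norm_le (1 : ℂ) (μ ^ L)
    rwa [norm_one] at this
  have h3 := norm_sub_le_norm_sub_add_norm_sub (z ^ L) (μ ^ L) 1
  linarith

theorem norm_pow_sub_pow_le {z ζ : ℂ} (hz : ‖z‖ = 1) (hζ : ‖ζ‖ = 1) (L : ℕ) :
    ‖z ^ L - ζ ^ L‖ ≤ L * ‖z - ζ‖ := by
  have h0 : ζ ≠ 0 := norm_ne_zero_iff.1 (by rw [hζ]; exact one_ne_zero)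
  have h1 : z ^ L - ζ ^ L = ζ ^ L * ((z / ζ) ^ L - 1) := by
    rw [div_pow]; field_simp
  have h2 : z / ζ - 1 = (z - ζ) / ζ := by field_simp
  have h3 := norm_pow_sub_one_le (μ := z / ζ) (by rw [norm_div, hz, hζ, div_one]) L
  rw [h2, norm_div, hζ, div_one] at h3
  rwa [h1, norm_mul, norm_pow, hζ, one_pow, one_mul]

/-! ### From random subsets of `ℕ` to configurations. -/

namespace CycleConfig

variable {n k : ℕ}

/-- The tails of the removed edges as natural numbers. -/
def removedNat (ω : CycleConfig n k) : Finset ℕ := ω.removed.map Fin.valEmbedding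

theorem mem_removedNat {ω : CycleConfig n k} {x : ℕ} :
    x ∈ ω.removedNat ↔ ∃ u ∈ ω.removed, u.val = x := by
  simp [removedNat]

/-- The block contains no other removed tail, so the two points are consecutive and their distance
is a gap length. -/
theorem exists_tail_of_isSpreadPair {ω : CycleConfig n k} {ζ : ℂ} {t : ℝ} {a s : ℕ}
    (h : IsSpreadPair ζ t (ω.removedNat ∩ Finset.Ico a (a + s))) :
    ∃ i : Fin k, a ≤ (ω.tail i).val ∧ (ω.tail i).val < a + s ∧
      t ≤ ‖ζ ^ (ω.offset (ω.tail i) + 1) - 1‖ := by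
  obtain ⟨r, d, hd, ht, he⟩ := h
  have hmem : ∀ x, (x ∈ ω.removedNat ∧ a ≤ x ∧ x < a + s) ↔ (x = r ∨ x = r + d) := by
    intro x
    have := Finset.ext_iff.1 he x
    simpa only [Finset.mem_inter, Finset.mem_Ico, Finset.mem_insert, Finset.mem_singleton]
      using this
  obtain ⟨hr, har, -⟩ := (hmem r).2 (Or.inl rfl)
  obtain ⟨hrd, -, hrds⟩ := (hmem (r + d)).2 (Or.inr rfl)
  obtain ⟨e, he, her⟩ := mem_removedNat.1 hr
  obtain ⟨u, hu, hur⟩ := mem_removedNat.1 hrd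
  refine ⟨ω.label u hu, ?_⟩
  rw [ω.tail_label hu]
  have hoff : ω.offset u + 1 = d := by
    refine offset_add_one_eq hd (by omega) ⟨e, he, by omega⟩ fun x hx hlt => ?_
    by_contra! hcon
    have := (hmem x.val).1 ⟨mem_removedNat.2 ⟨x, hx, rfl⟩, by omega, by omega⟩
    omega
  rw [hoff]
  exact ⟨by omega, by omega, ht⟩

theorem exists_tail_of_hasSpreadPairs {ω : CycleConfig n k} {ζ : ℂ} {t : ℝ} {Q m : ℕ}
    (h : HasSpreadPairs n Q m t ζ ω.removedNat) {b : ℕ} (hb : (b + 1) * (m * (4 * Q)) ≤ n) :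
    ∃ i : Fin k, (ω.tail i).val / (m * (4 * Q)) = b ∧
      t ≤ ‖ζ ^ (ω.offset (ω.tail i) + 1) - 1‖ := by
  obtain ⟨j, hj, hpair⟩ := h b hb
  obtain ⟨i, h1, h2, h3⟩ := exists_tail_of_isSpreadPair hpair
  refine ⟨i, ?_, h3⟩
  have h4 : (j + 1) * (4 * Q) ≤ m * (4 * Q) := Nat.mul_le_mul_right _ hj
  refine Nat.div_eq_of_lt_le (by omega) ?_
  rw [add_mul] at h4 ⊢
  omega

/-- Every full interval contains a removed tail. The factor `3` covers the worst case, crossing `0`: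
part of the first interval, the incomplete remainder at the end, and the last full interval. -/
theorem gapsLE_of_hasSpreadPairs {ω : CycleConfig n k} {ζ : ℂ} {t : ℝ} {Q m : ℕ}
    (h : HasSpreadPairs n Q m t ζ ω.removedNat) (hQ : 0 < m * (4 * Q)) (hn : m * (4 * Q) ≤ n) :
    ω.GapsLE (3 * (m * (4 * Q))) := by
  have key : ∀ b, (b + 1) * (m * (4 * Q)) ≤ n → ∃ r ∈ ω.removed,
      b * (m * (4 * Q)) ≤ r.val ∧ r.val < (b + 1) * (m * (4 * Q)) := by
    intro b hb
    obtain ⟨i, hi, -⟩ := exists_tail_of_hasSpreadPairs h hb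
    refine ⟨ω.tail i, ω.tail_mem i, ?_, ?_⟩
    · rw [← hi]; exact Nat.div_mul_le_self _ _
    · rw [← hi, mul_comm]; exact Nat.lt_mul_div_succ _ hQ
  generalize m * (4 * Q) = ℓ at *
  intro u
  have hu := u.isLt
  by_cases hul : ℓ ≤ u.val
  · have h1 : 1 ≤ u.val / ℓ := (Nat.one_le_div_iff hQ).2 hul
    have h2 : u.val / ℓ * ℓ ≤ u.val := Nat.div_mul_le_self _ _
    have h3 : u.val < (u.val / ℓ + 1) * ℓ := by rw [mul_comm]; exact Nat.lt_mul_div_succ _ hQ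
    obtain ⟨a, ha⟩ := Nat.exists_eq_add_of_le' h1
    rw [ha] at h2 h3
    obtain ⟨r, hr, hr1, hr2⟩ := key a (h2.trans hu.le)
    rw [add_mul, add_mul] at h3
    rw [add_mul] at hr2 h2
    refine ⟨u.val - r.val - 1, by omega, ?_⟩
    rw [show u.val - r.val - 1 + 1 = u.val - r.val by omega,
      iterate_finRotate_symm_eq (r := r)]
    · exact hr
    · rw [show r.val + (u.val - r.val) = u.val by omega, Nat.mod_eq_of_lt hu]
  · have h1 : 1 ≤ n / ℓ := (Nat.one_le_div_iff hQ).2 hn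
    have h2 : n / ℓ * ℓ ≤ n := Nat.div_mul_le_self _ _
    have h3 : n < (n / ℓ + 1) * ℓ := by rw [mul_comm]; exact Nat.lt_mul_div_succ _ hQ
    obtain ⟨a, ha⟩ := Nat.exists_eq_add_of_le' h1
    rw [ha] at h2 h3
    obtain ⟨r, hr, hr1, hr2⟩ := key a h2
    have hrn := r.isLt
    rw [add_mul, add_mul] at h3
    rw [add_mul] at hr2 h2
    refine ⟨u.val + n - r.val - 1, by omega, ?_⟩
    rw [show u.val + n - r.val - 1 + 1 = u.val + n - r.val by omega,
      iterate_finRotate_symm_eq (r := r)]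
    · exact hr
    · rw [show r.val + (u.val + n - r.val) = u.val + n by omega, Nat.add_mod_right,
        Nat.mod_eq_of_lt hu]

/-- Different blocks provide different labels, so at least `J` terms are at least `x`. -/
theorem mul_le_sum_of_forall_block (ω : CycleConfig n k) {f : Fin k → ℝ} (hf : ∀ i, 0 ≤ f i)
    {ℓ J : ℕ} {x : ℝ} (h : ∀ b < J, ∃ i, (ω.tail i).val / ℓ = b ∧ x ≤ f i) :
    J * x ≤ ∑ i, f i := by
  classical
  rcases le_or_gt x 0 with hx | hx
  · exact (mul_nonpos_of_nonneg_of_nonpos (Nat.cast_nonneg _) hx).trans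
      (Finset.sum_nonneg fun i _ => hf i)
  set S : Finset (Fin k) := {i | x ≤ f i}
  have hsub : Finset.range J ⊆ S.image fun i => (ω.tail i).val / ℓ := by
    intro b hb
    obtain ⟨i, hi, hxi⟩ := h b (Finset.mem_range.1 hb)
    exact Finset.mem_image.2 ⟨i, by simpa [S] using hxi, hi⟩
  have hcard : J ≤ S.card := by
    simpa using (Finset.card_le_card hsub).trans Finset.card_image_le
  calc (J : ℝ) * x ≤ S.card * x := by gcongr
    _ = ∑ i ∈ S, x := by simp
    _ ≤ ∑ i ∈ S, f i := Finset.sum_le_sum fun i hi => by simpa [S] using hi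
    _ ≤ ∑ i, f i := Finset.sum_le_sum_of_subset_of_nonneg (Finset.subset_univ _)
        fun i _ _ => hf i

noncomputable instance : Fintype (CycleConfig n k) :=
  Fintype.ofInjective (fun ω => (ω.removed, ω.first)) fun ω ω' h => by
    cases ω; cases ω'; simp_all

theorem card_filter_removed (P : Finset (Fin n) → Prop) [DecidablePred P] :
    (Finset.univ.filter fun ω : CycleConfig n k => P ω.removed).card =
      ((Finset.powersetCard k Finset.univ).filter P).card * k := by
  classical
  have h1 : ∀ S ∈ (Finset.powersetCard k (Finset.univ : Finset (Fin n))).filter P,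
      S.card = k := fun S hS => (Finset.mem_powersetCard.1 (Finset.mem_filter.1 hS).1).2
  rw [← smul_eq_mul, ← Finset.sum_const, ← Finset.sum_congr rfl h1, ← Finset.card_sigma]
  refine Finset.card_bij (fun ω _ => ⟨ω.removed, ω.first⟩) ?_ ?_ ?_
  · intro ω hω
    simp only [Finset.mem_filter, Finset.mem_univ, true_and] at hω
    simp [hω, ω.card_removed, ω.first_mem, Finset.mem_powersetCard]
  · intro ω _ ω' _ h
    cases ω; cases ω'
    simp_all
  · rintro ⟨S, v⟩ hS
    simp only [Finset.mem_sigma, Finset.mem_filter, Finset.mem_powersetCard] at hS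
    exact ⟨⟨S, hS.1.1.2, v, hS.2⟩, by simp [hS.1.2], rfl⟩

theorem card_filter_map_le (P : Finset ℕ → Prop) [DecidablePred P] :
    ((Finset.powersetCard k (Finset.univ : Finset (Fin n))).filter
      fun S => P (S.map Fin.valEmbedding)).card ≤
      ((Finset.powersetCard k (Finset.range n)).filter P).card := by
  refine Finset.card_le_card_of_injOn (fun S => S.map Fin.valEmbedding) ?_
    fun _ _ _ _ h => Finset.map_injective _ h
  intro S hS
  rw [Finset.mem_coe, Finset.mem_filter, Finset.mem_powersetCard] at hS ⊢
  refine ⟨⟨?_, by rw [Finset.card_map]; exact hS.1.2⟩, hS.2⟩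
  intro x hx
  obtain ⟨u, -, rfl⟩ := Finset.mem_map.1 hx
  exact Finset.mem_range.2 u.isLt

theorem cycleLaw_le (hk : 0 < k) (hkn : k ≤ n) (P : Finset ℕ → Prop) [DecidablePred P] {x : ℝ}
    (hx : (((Finset.powersetCard k (Finset.range n)).filter P).card : ℝ) ≤ n.choose k * x) :
    cycleLaw n k {ω | P ω.removedNat} ≤ ENNReal.ofReal x := by
  classical
  have hcard : Fintype.card (CycleConfig n k) = n.choose k * k := by
    have := card_filter_removed (n := n) (k := k) fun _ => True
    simpa using this
  have hpos : 0 < n.choose k * k := Nat.mul_pos (Nat.choose_pos hkn) hk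
  have hset : {ω : CycleConfig n k | P ω.removedNat} = ((Finset.univ.filter
      fun ω : CycleConfig n k => P (ω.removed.map Fin.valEmbedding) : Finset _) : Set _) := by
    ext ω; simp [removedNat]
  have hcount : (Finset.univ.filter
      fun ω : CycleConfig n k => P (ω.removed.map Fin.valEmbedding)).card ≤
      ((Finset.powersetCard k (Finset.range n)).filter P).card * k := by
    rw [card_filter_removed fun S => P (S.map Fin.valEmbedding)]
    exact Nat.mul_le_mul_right _ (card_filter_map_le P)
  rw [cycleLaw, hset]
  have : MeasurableSingletonClass (CycleConfig n k) := ⟨fun _ => trivial⟩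
  rw [ProbabilityTheory.uniformOn_univ, MeasureTheory.Measure.count_apply_finset, hcard]
  rw [ENNReal.div_le_iff (by exact_mod_cast hpos.ne') (ENNReal.natCast_ne_top _),
    ← ENNReal.ofReal_natCast, ← ENNReal.ofReal_natCast,
    ← ENNReal.ofReal_mul' (Nat.cast_nonneg _)]
  refine ENNReal.ofReal_le_ofReal ?_
  have h1 : ((Finset.univ.filter
      fun ω : CycleConfig n k => P (ω.removed.map Fin.valEmbedding)).card : ℝ) ≤
      ((Finset.powersetCard k (Finset.range n)).filter P).card * k := by exact_mod_cast hcount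
  refine h1.trans ((mul_le_mul_of_nonneg_right hx (Nat.cast_nonneg k)).trans (le_of_eq ?_))
  push_cast
  ring

theorem isProbabilityMeasure_cycleLaw (hk : 0 < k) (hkn : k ≤ n) :
    MeasureTheory.IsProbabilityMeasure (cycleLaw n k) := by
  have : MeasurableSingletonClass (CycleConfig n k) := ⟨fun _ => trivial⟩
  obtain ⟨S, -, hS⟩ := Finset.exists_subset_card_eq (s := (Finset.univ : Finset (Fin n)))
    (n := k) (by simpa using hkn)
  obtain ⟨v, hv⟩ := Finset.card_pos.1 (hS.symm ▸ hk)
  exact ProbabilityTheory.isProbabilityMeasure_uniformOn Set.finite_univ ⟨⟨S, hS, v, hv⟩, trivial⟩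

end CycleConfig

/-! ### Spread configurations have the gap, and most configurations are spread. -/

namespace CycleConfig

open Matrix

variable {n k : ℕ}

/-- The spread condition at all net points away from `1`. -/
def IsSpread (Z : Finset ℂ) (Q m : ℕ) (t : ℝ) (R : Finset ℕ) (n : ℕ) : Prop :=
  ∀ ζ ∈ Z, 2 * t / Q ≤ ‖ζ - 1‖ → HasSpreadPairs n Q m t ζ R

theorem isIrreducible_and_gap_of_isSpread {A : Matrix (Fin k) (Fin k) ℝ} (hsymm : A.IsSymm)
    (hA : A ∈ doublyStochastic ℝ (Fin k)) (hirr : A.IsIrreducible) {δ κ ε t : ℝ} (hδ : 0 < δ)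
    (hgap : δ ≤ spectralGap A) (hkn : k < n) {Q m : ℕ} (hQ : 0 < Q) (hm : 0 < m)
    (ht : t = 1 / (192 * m)) {Z : Finset ℂ} (hZ1 : ∀ ζ ∈ Z, ‖ζ‖ = 1) (hZneg : (-1 : ℂ) ∈ Z)
    (hZnet : ∀ z : ℂ, ‖z‖ = 1 → ∃ ζ ∈ Z, ‖z - ζ‖ ≤ 7 / n) {ω : CycleConfig n k}
    (hω : IsSpread Z Q m t ω.removedNat n) (hn2 : 2 * (m * (4 * Q)) ≤ n)
    (hε : ε = (3 * (m * (4 * Q)) : ℕ) * κ) (hε4 : ε ≤ 1 / 4) (hεδ : 4 * ε ≤ δ)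
    (hsmall : 16 * ε * ((3 * (m * (4 * Q)) : ℕ) * k : ℝ) ^ 2 < δ * (n : ℝ) ^ 2)
    (hlarge : 32 * ε * k * (m * (4 * Q) : ℕ) < δ * n * (t / 4) ^ 2)
    (hnet : (3 * (m * (4 * Q)) : ℕ) * (7 / n : ℝ) ≤ t / 2) :
    (ω.transition A).IsIrreducible ∧ κ ≤ spectralGap (ω.transition A) := by
  have hm' : (1 : ℝ) ≤ m := by exact_mod_cast hm
  have hQ' : (1 : ℝ) ≤ Q := by exact_mod_cast hQ
  have hn' : (0 : ℝ) < n := by exact_mod_cast (by omega : 0 < n)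
  have hℓ : 0 < m * (4 * Q) := Nat.mul_pos hm (by omega)
  have ht0 : 0 < t := by rw [ht]; positivity
  have htle : t ≤ 1 / 192 := by
    rw [ht]
    exact one_div_le_one_div_of_le (by norm_num) (by linarith)
  have hfar : ∀ ζ ∈ Z, 2 * t / Q ≤ ‖ζ - 1‖ → HasSpreadPairs n Q m t ζ ω.removedNat := hω
  -- The net point `-1` is certainly far from `1`, so its spread pairs bound the gaps.
  have hgaps : ω.GapsLE (3 * (m * (4 * Q))) := by
    refine gapsLE_of_hasSpreadPairs (hfar (-1) hZneg ?_) hℓ (by omega)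
    rw [div_le_iff₀ (by linarith)]
    have : ‖(-1 : ℂ) - 1‖ = 2 := by norm_num
    rw [this]
    linarith
  have hH := ω.transition_mem_doublyStochastic hA
  refine ⟨transition_isIrreducible hsymm hA hirr (hδ.trans_le hgap) hgaps, ?_⟩
  obtain ⟨u, hu⟩ : ∃ u, u ∉ ω.removed := by
    by_contra! hall
    have h1 := ω.card_removed
    rw [Finset.eq_univ_of_forall hall, Finset.card_univ, Fintype.card_fin] at h1
    omega
  have hdiag : ω.transition A u u = 0 := by
    rw [ω.transition_apply_of_notMem A hu, if_neg]
    intro h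
    have h1 := congrArg Fin.val h
    have h2 := val_iterate_finRotate u 1
    rw [Function.iterate_one, ← h1] at h2
    have h3 := u.isLt
    have h4 : 2 ≤ n := by omega
    rcases Nat.lt_or_ge (u.val + 1) n with h5 | h5
    · rw [Nat.mod_eq_of_lt h5] at h2; omega
    · have h6 : u.val + 1 = n := by omega
      rw [h6, Nat.mod_self] at h2
      omega
  -- The set in `spectralGap` has to be nonempty, since `sInf ∅ = 0` would be useless; the vertex
  -- `u` with a kept edge has a zero diagonal entry.
  obtain ⟨μ₀, hμ₀, hμ₀e⟩ := exists_eigenvalue_ne_one hH hdiag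
  refine le_csInf ⟨_, μ₀, hμ₀, hμ₀e, rfl⟩ ?_
  rintro r ⟨μ, hμ1, hμe, rfl⟩
  by_contra! hlt
  obtain ⟨v, hv0, hv⟩ := hasEigenvalue_toLin'_iff_exists.1 hμe
  have hμle := norm_eigenvalue_le_one hH hv0 hv
  set M : ℕ := 3 * (m * (4 * Q)) with hM
  have hMQ : (M : ℝ) = 12 * m * Q := by rw [hM]; push_cast; ring
  have hM1 : (1 : ℝ) ≤ M := by exact_mod_cast (by omega : 1 ≤ M)
  have hκM : κ ≤ 1 / (4 * M) := by
    rw [le_div_iff₀ (by linarith)]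
    linarith
  have hκ4 : κ ≤ 1 / 4 := by
    refine hκM.trans (one_div_le_one_div_of_le (by norm_num) (by linarith))
  refine false_of_eigenvector hsymm hA hirr hδ hgap hgaps hμ1 hv0 hv (by linarith) hεδ ?_
    hsmall ?_
  -- By Bernoulli's inequality `‖μ‖ ^ M ≥ 1 - M * κ = 1 - ε`.
  · have := one_add_mul_le_pow (a := ‖μ‖ - 1) (by linarith [norm_nonneg μ]) M
    rw [add_sub_cancel] at this
    refine le_trans ?_ this
    rw [hε]
    nlinarith
  · intro hfar1
    have hμ0 : μ ≠ 0 := by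
      rintro rfl
      rw [norm_zero] at hlt
      linarith
    have hnμ : 0 < ‖μ‖ := norm_pos_iff.2 hμ0
    have hnμ' : (‖μ‖ : ℂ) ≠ 0 := by exact_mod_cast hnμ.ne'
    set z : ℂ := μ / ‖μ‖ with hz
    have hz1 : ‖z‖ = 1 := by
      rw [hz, norm_div, Complex.norm_real, norm_norm, div_self hnμ.ne']
    have hzμ : ‖μ - z‖ ≤ 1 / (4 * M) := by
      have h1 : μ - z = z * ((‖μ‖ - 1 : ℝ) : ℂ) := by
        rw [hz]; push_cast; field_simp
      rw [h1, norm_mul, hz1, one_mul, Complex.norm_real, Real.norm_eq_abs, abs_of_nonpos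
        (by linarith)]
      linarith
    obtain ⟨ζ, hζZ, hζ⟩ := hZnet z hz1
    have hζ1 := hZ1 ζ hζZ
    have h7 : (7 / n : ℝ) ≤ 1 / (8 * M) := by
      rw [le_div_iff₀ (by linarith)]
      linarith
    have hζfar : 2 * t / Q ≤ ‖ζ - 1‖ := by
      -- The value `t = 1 / (192 * m)` is made for this: out of the distance `1 / (2 * M)` from `μ`
      -- to `1`, projection loses `1 / (4 * M)` and the net loses `1 / (8 * M)`.
      have e1 : 2 * t / Q = 1 / (8 * M) := by
        rw [ht, hMQ]; field_simp; norm_num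
      have e2 : 1 / (2 * M : ℝ) ≤ ‖μ - 1‖ := by
        rw [div_le_iff₀ (by linarith)]; linarith
      have e3 : ‖μ - 1‖ ≤ ‖μ - z‖ + (‖z - ζ‖ + ‖ζ - 1‖) :=
        (norm_sub_le_norm_sub_add_norm_sub μ z 1).trans
          (add_le_add_right (norm_sub_le_norm_sub_add_norm_sub z ζ 1) _)
      have e4 : 1 / (2 * M : ℝ) = 1 / (8 * M) + 1 / (8 * M) + 1 / (4 * M) := by
        field_simp; norm_num
      linarith
    have hpairs := hfar ζ hζZ hζfar
    have hsum := ω.mul_le_sum_of_forall_block (f := fun i =>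
      ‖μ ^ (ω.offset (ω.tail i) + 1) - 1‖ ^ 2) (fun i => sq_nonneg _)
      (ℓ := m * (4 * Q)) (J := n / (m * (4 * Q))) (x := (t / 4) ^ 2) ?_
    -- The floor loses at most a factor `2`, as at least one full interval fits.
    · have hJ : (n : ℝ) ≤ 2 * (m * (4 * Q) : ℕ) * (n / (m * (4 * Q)) : ℕ) := by
        have h1 := Nat.lt_mul_div_succ n hℓ
        have h2 : m * (4 * Q) * 2 ≤ m * (4 * Q) * (n / (m * (4 * Q)) + 1) := by
          refine Nat.mul_le_mul_left _ ?_
          have := (Nat.one_le_div_iff hℓ).2 (by omega : m * (4 * Q) ≤ n)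
          omega
        have h3 : 1 ≤ n / (m * (4 * Q)) := (Nat.one_le_div_iff hℓ).2 (by omega)
        have h4 : n ≤ 2 * (m * (4 * Q)) * (n / (m * (4 * Q))) := by nlinarith
        exact_mod_cast h4
      generalize n / (m * (4 * Q)) = J at hsum hJ
      generalize m * (4 * Q) = ℓ at *
      have hℓ' : (0 : ℝ) < 2 * ℓ := by exact_mod_cast (by omega : 0 < 2 * ℓ)
      refine lt_of_mul_lt_mul_right ?_ hℓ'.le
      have h1 : δ * n * (t / 4) ^ 2 ≤ δ * (2 * ℓ * J) * (t / 4) ^ 2 := by gcongr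
      have h2 := mul_le_mul_of_nonneg_left hsum (mul_nonneg hδ.le hℓ'.le)
      calc _ = 32 * ε * k * ℓ := by ring
        _ < _ := hlarge
        _ ≤ _ := h1
        _ = δ * (2 * ℓ) * (J * (t / 4) ^ 2) := by ring
        _ ≤ _ := h2
        _ = _ := by ring
    · intro b hb
      obtain ⟨i, hi, hti⟩ := exists_tail_of_hasSpreadPairs hpairs (b := b)
        ((Nat.mul_le_mul_right _ hb).trans (Nat.div_mul_le_self _ _))
      -- Passing from `ζ` to `z` costs `t / 2`, and passing from `z` to `μ` halves the rest, whence
      -- `t / 4`.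
      refine ⟨i, hi, pow_le_pow_left₀ (by positivity) ?_ 2⟩
      set L := ω.offset (ω.tail i) + 1
      have hL : (L : ℝ) ≤ M := by exact_mod_cast hgaps.offset_lt (ω.tail i)
      have e1 : ‖z ^ L - ζ ^ L‖ ≤ t / 2 := by
        refine (norm_pow_sub_pow_le hz1 hζ1 L).trans (le_trans ?_ hnet)
        exact mul_le_mul hL hζ (norm_nonneg _) (by linarith)
      have e2 := norm_div_norm_pow_sub_one_le hμ0 L
      have e3 := norm_sub_le_norm_sub_add_norm_sub (ζ ^ L) (z ^ L) 1
      rw [norm_sub_rev (ζ ^ L) (z ^ L)] at e3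
      linarith

/-- There are `n + 1` net points, `n` intervals and the conditioning factor `n + 1`, and `n * (n +
1) ^ 2 ≤ 4 * n ^ 3`. -/
theorem cycleLaw_not_isSpread_le {Q m : ℕ} (hk : 0 < k) (hkn : k < n) (hm : 0 < m) {t : ℝ}
    (ht0 : 0 < t) (ht : t ≤ 1 / 4) (hqQ : 1 / 16 ≤ (k / n : ℝ) * Q)
    (hqQ' : (k / n : ℝ) * Q ≤ 1 / 8) {Z : Finset ℂ} (hZ : ∀ ζ ∈ Z, ‖ζ‖ = 1)
    (hZcard : Z.card ≤ n + 1) :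
    cycleLaw n k {ω | ¬ IsSpread Z Q m t ω.removedNat n} ≤
      ENNReal.ofReal (4 * (n : ℝ) ^ 3 * Real.exp (-(m / 1024))) := by
  classical
  have hn1 : (1 : ℝ) ≤ n := by exact_mod_cast (by omega : 1 ≤ n)
  refine cycleLaw_le hk hkn.le (fun R => ¬ IsSpread Z Q m t R n) ?_
  have h1 := card_not_hasSpreadPairs_le (m := m) hkn ht0 ht hm hqQ hqQ'
    (Z.filter fun ζ => 2 * t / Q ≤ ‖ζ - 1‖)
    (fun ζ hζ => ⟨hZ ζ (Finset.mem_filter.1 hζ).1, (Finset.mem_filter.1 hζ).2⟩)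
    (fun R => ¬ IsSpread Z Q m t R n) (fun R hR => by
      simp only [IsSpread, not_forall] at hR
      obtain ⟨ζ, h1, h2, h3⟩ := hR
      exact ⟨ζ, Finset.mem_filter.2 ⟨h1, h2⟩, h3⟩)
  refine h1.trans ?_
  have h2 : ((Z.filter fun ζ => 2 * t / Q ≤ ‖ζ - 1‖).card : ℝ) ≤ n + 1 := by
    exact_mod_cast (Finset.card_filter_le _ _).trans hZcard
  have h3 : (1 - 1 / 1024 : ℝ) ^ m ≤ Real.exp (-(m / 1024)) := by
    have := Real.one_sub_le_exp_neg (1 / 1024 : ℝ)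
    refine (pow_le_pow_left₀ (by norm_num) this m).trans (le_of_eq ?_)
    rw [← Real.exp_nat_mul]
    congr 1; ring
  calc _ ≤ (n + 1 : ℝ) * n * ((n + 1) * n.choose k * Real.exp (-(m / 1024))) := by
        gcongr
    _ = n.choose k * (((n + 1) ^ 2 * n) * Real.exp (-(m / 1024))) := by ring
    _ ≤ n.choose k * (4 * (n : ℝ) ^ 3 * Real.exp (-(m / 1024))) := by
        refine mul_le_mul_of_nonneg_left (mul_le_mul_of_nonneg_right ?_ (Real.exp_nonneg _))
          (Nat.cast_nonneg _)
        nlinarith [mul_nonneg (mul_nonneg (Nat.cast_nonneg n) (sub_nonneg.2 hn1))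
          (by positivity : (0 : ℝ) ≤ 3 * n + 1)]

end CycleConfig

/-! ### Choice of parameters and the limit. -/

-- With `Q = ⌊n / (8 k)⌋` a block has mean `4 * Q * k / n` between `1 / 4` and `1 / 2`. With `m = ⌈C
-- log k⌉` the factor `exp (-m / 1024) ≤ k ^ (-(3 ρu + 1))` beats `n ^ 3 ≤ k ^ (3 ρu)` and leaves `4
-- / k`. The spectral conditions reduce to `ε * m ^ 3` being small against `δ`, where `9437184 = 16
-- * 768 ^ 2`.
set_option maxHeartbeats 1000000 in
theorem cycleLaw_compl_le {c α ρl ρu γ : ℝ} (hρl : 1 < ρl) (hρ : ρl < ρu)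
    {n k : ℕ} {A : Matrix (Fin k) (Fin k) ℝ} (hA : A ∈ gapClass c α k) (hc : 0 < c)
    (h1 : 1 ≤ Real.log k) (hl : ρl < Real.log n / Real.log k) (hu : Real.log n / Real.log k < ρu)
    {C : ℝ} (hC : C = 1024 * (3 * ρu + 1)) (h16 : Real.log 16 ≤ (ρl - 1) * Real.log k)
    (hk2 : 4032 * (2 * C * Real.log k) ^ 2 ≤ k)
    (hε : 3 / 2 * (2 * C * Real.log k) * Real.log k ^ (-γ) ≤ 1 / 4)
    (hδ : 9437184 * (3 / 2 * (2 * C * Real.log k) * Real.log k ^ (-γ)) *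
      (2 * C * Real.log k) ^ 3 < c * Real.log k ^ (-α)) :
    cycleLaw n k {ω | (ω.transition A).IsIrreducible ∧
        (k : ℝ) / (n * Real.log k ^ γ) ≤ spectralGap (ω.transition A)}ᶜ ≤
      ENNReal.ofReal (4 * Real.exp (-Real.log k)) := by
  obtain ⟨hsymm, hds, hirr, hgap⟩ := hA
  set x := Real.log k with hx
  have hx0 : 0 < x := by linarith
  have hk0 : 0 < k := by
    rcases Nat.eq_zero_or_pos k with rfl | h
    · simp [hx] at h1; linarith
    · exact h
  have hkR : (0 : ℝ) < k := by exact_mod_cast hk0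
  rw [lt_div_iff₀ hx0] at hl
  rw [div_lt_iff₀ hx0] at hu
  have hn0 : 0 < n := by
    rcases Nat.eq_zero_or_pos n with rfl | h
    · simp at hl; nlinarith
    · exact h
  have hnR : (0 : ℝ) < n := by exact_mod_cast hn0
  have hn16 : (16 : ℝ) * k ≤ n := by
    rw [← Real.log_le_log_iff (by positivity) hnR, Real.log_mul (by norm_num) hkR.ne']
    linarith
  have hnle : (n : ℝ) ≤ Real.exp (ρu * x) := by
    rw [← Real.log_le_iff_le_exp hnR]; exact hu.le
  have hkn : k < n := by
    have : (k : ℝ) < n := by linarith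
    exact_mod_cast this
  have hC1 : 1 ≤ C := by rw [hC]; linarith
  have hCx : 1 ≤ C * x := by nlinarith
  set m := ⌈C * x⌉₊ with hm
  have hm1 : C * x ≤ m := Nat.le_ceil _
  have hm2 : (m : ℝ) ≤ 2 * C * x := by
    have := Nat.ceil_lt_add_one (by linarith : 0 ≤ C * x)
    linarith
  have hm0 : 0 < m := Nat.ceil_pos.2 (by linarith)
  have hmR : (1 : ℝ) ≤ m := by exact_mod_cast hm0
  set B := 2 * C * x with hB
  have hB1 : 1 ≤ B := hmR.trans hm2
  set Q := n / (8 * k) with hQ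
  have hQ1 : (Q : ℝ) * (8 * k) ≤ n := by exact_mod_cast Nat.div_mul_le_self n (8 * k)
  -- Since `16 * k ≤ n`, rounding down loses at most half of `n / (8 * k)`.
  have hQ2 : (n : ℝ) ≤ 16 * k * Q := by
    have h2 : n < 8 * k * (n / (8 * k) + 1) := Nat.lt_mul_div_succ n (by omega)
    have h3 : (n : ℝ) < 8 * k * (Q + 1) := by exact_mod_cast h2
    linarith
  have hQ0 : 0 < Q := Nat.div_pos (by
    have : 16 * k ≤ n := by exact_mod_cast hn16
    omega) (by omega)
  have hkℓ : (k : ℝ) * (m * (4 * Q)) ≤ m * n / 2 := by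
    have := mul_le_mul_of_nonneg_left hQ1 (by linarith : (0 : ℝ) ≤ m)
    linarith
  have hg : 0 < x ^ (-γ) := Real.rpow_pos_of_pos hx0 _
  set D := 3 / 2 * B * x ^ (-γ) with hD
  have hD0 : 0 < D := by positivity
  set κ : ℝ := k / (n * x ^ γ) with hκ
  have hκe : κ = k / n * x ^ (-γ) := by
    rw [hκ, Real.rpow_neg hx0.le]; field_simp
  obtain ⟨ε, hεdef⟩ : ∃ ε : ℝ, ε = (3 * (m * (4 * Q)) : ℕ) * κ := ⟨_, rfl⟩
  have hε0 : 0 ≤ ε := by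
    rw [hεdef]
    have hκ0 : 0 ≤ κ := by positivity
    positivity
  have hεD : ε ≤ D := by
    have h2 : ε = 3 * (k * (m * (4 * Q))) / n * x ^ (-γ) := by
      rw [hεdef, hκe]; push_cast; ring
    rw [h2, hD]
    refine mul_le_mul_of_nonneg_right ?_ hg.le
    rw [div_le_iff₀ hnR]
    have := mul_le_mul_of_nonneg_right hm2 hnR.le
    linarith
  have hB3 : B ≤ B ^ 3 := le_self_pow₀ hB1 (by norm_num)
  have hB2 : B ^ 2 ≤ B ^ 3 := pow_le_pow_right₀ hB1 (by norm_num)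
  set δ := c * x ^ (-α) with hδdef
  have hδ0 : 0 < δ := mul_pos hc (Real.rpow_pos_of_pos hx0 _)
  have hεm : ∀ j ≤ 3, ε * (m : ℝ) ^ j ≤ D * B ^ 3 := fun j hj =>
    mul_le_mul hεD ((pow_le_pow_left₀ (by linarith) hm2 j).trans (pow_le_pow_right₀ hB1 hj))
      (by positivity) hD0.le
  have hem0 := hεm 0 (by norm_num)
  have hem2 := hεm 2 (by norm_num)
  have hem3 := hεm 3 le_rfl
  rw [pow_zero, mul_one] at hem0
  have hDB : 0 < D * B ^ 3 := by positivity
  obtain ⟨Z, hZcard, hZ1, hZneg, hZnet⟩ := exists_unit_circle_net n hn0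
  have hprob := CycleConfig.cycleLaw_not_isSpread_le (Q := Q) (m := m) (t := 1 / (192 * m)) hk0 hkn
    hm0 (by positivity) (by
      exact one_div_le_one_div_of_le (by norm_num) (by linarith))
    (by rw [div_mul_eq_mul_div, le_div_iff₀ hnR]; linarith)
    (by rw [div_mul_eq_mul_div, div_le_iff₀ hnR]; linarith) hZ1 hZcard
  refine (MeasureTheory.measure_mono ?_).trans (hprob.trans (ENNReal.ofReal_le_ofReal ?_))
  · intro ω hω hspread
    refine hω (CycleConfig.isIrreducible_and_gap_of_isSpread hsymm hds hirr hδ0 hgap hkn hQ0 hm0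
      rfl hZ1 hZneg hZnet hspread ?_ hεdef (hεD.trans hε) (by linarith) ?_ ?_ ?_)
    · have h2 : (m : ℝ) ≤ k := by
        have h4 : B ≤ B ^ 2 := le_self_pow₀ hB1 (by norm_num)
        linarith [sq_nonneg B]
      have h3 : (2 * (m * (4 * Q)) : ℝ) ≤ n := by
        have h4 : (Q : ℝ) * (8 * m) ≤ Q * (8 * k) := by gcongr
        linarith
      exact_mod_cast h3
    · push_cast
      have h2 : (3 * (m * (4 * Q)) * k : ℝ) ^ 2 ≤ (3 / 2 * (m * n)) ^ 2 :=
        pow_le_pow_left₀ (by positivity) (by linarith) 2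
      have h3 : 36 * (ε * m ^ 2) < δ := by linarith
      calc 16 * ε * (3 * (m * (4 * Q)) * k : ℝ) ^ 2 ≤ 16 * ε * (3 / 2 * (m * n)) ^ 2 := by
            gcongr
        _ = 36 * (ε * m ^ 2) * n ^ 2 := by ring
        _ < δ * n ^ 2 := mul_lt_mul_of_pos_right h3 (by positivity)
    · push_cast
      have h2 : δ * n * (1 / (192 * m) / 4) ^ 2 = δ / (768 * m) ^ 2 * n := by
        field_simp; norm_num
      rw [h2]
      have h3 : 16 * ε * m < δ / (768 * m) ^ 2 := by
        rw [lt_div_iff₀ (by positivity)]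
        calc 16 * ε * m * (768 * m) ^ 2 = 9437184 * (ε * m ^ 3) := by ring
          _ < δ := by linarith
      calc 32 * ε * k * (m * (4 * Q)) = 32 * ε * (k * (m * (4 * Q))) := by ring
        _ ≤ 32 * ε * (m * n / 2) := by gcongr
        _ = 16 * ε * m * n := by ring
        _ < _ := mul_lt_mul_of_pos_right h3 hnR
    · push_cast
      -- The net condition amounts to `8064 * m * (m * (4 * Q)) ≤ n`, and `m * (4 * Q) ≤ m * n / (2
      -- * k)`.
      have h2 : 4032 * (m : ℝ) ^ 2 ≤ k := by
        refine le_trans ?_ hk2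
        gcongr
      rw [mul_div_assoc', div_div, div_le_div_iff₀ hnR (by positivity)]
      have h3 : 4032 * (m : ℝ) ^ 2 * (m * (4 * Q)) ≤ k * (m * (4 * Q)) := by gcongr
      have h4 : 4032 * (m : ℝ) ^ 2 * (m * (4 * Q)) ≤ m * (n / 2) := by linarith
      have h5 : 4032 * (m : ℝ) * (m * (4 * Q)) ≤ n / 2 := by
        refine le_of_mul_le_mul_left ?_ (by linarith : (0 : ℝ) < m)
        linarith
      linarith
  · have h2 : (n : ℝ) ^ 3 ≤ Real.exp (3 * (ρu * x)) := by
      refine (pow_le_pow_left₀ hnR.le hnle 3).trans (le_of_eq ?_)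
      rw [← Real.exp_nat_mul]; norm_num
    have h3 : Real.exp (-(m / 1024)) ≤ Real.exp (-((3 * ρu + 1) * x)) := by
      refine Real.exp_le_exp.2 ?_
      rw [hC] at hm1
      linarith
    calc 4 * (n : ℝ) ^ 3 * Real.exp (-(m / 1024))
        ≤ 4 * Real.exp (3 * (ρu * x)) * Real.exp (-((3 * ρu + 1) * x)) := by gcongr
      _ = 4 * Real.exp (-x) := by
          rw [mul_assoc, ← Real.exp_add]; congr 2; ring

theorem eventually_mul_rpow_lt {a b : ℝ} (ha : a < b) (K : ℝ) {c : ℝ} (hc : 0 < c) :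
    ∀ᶠ x : ℝ in atTop, K * x ^ a < c * x ^ b := by
  have h1 : Tendsto (fun x : ℝ => K * x ^ (-(b - a))) atTop (𝓝 (K * 0)) :=
    (tendsto_rpow_neg_atTop (by linarith : 0 < b - a)).const_mul K
  rw [mul_zero] at h1
  filter_upwards [h1.eventually_lt_const hc, eventually_gt_atTop 0] with x hx hx0
  have h2 : x ^ a = x ^ (-(b - a)) * x ^ b := by
    rw [← Real.rpow_add hx0]; congr 1; ring
  rw [h2, ← mul_assoc]
  exact mul_lt_mul_of_pos_right hx (Real.rpow_pos_of_pos hx0 _)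

theorem theorem2 (c α ρl ρu γ : ℝ) (hc : 0 < c) (hα : 0 ≤ α) (hρl : 1 < ρl) (hρ : ρl < ρu)
    (hγ : 7 + α < γ) (n k : ℕ → ℕ) (hn : Tendsto n atTop atTop) (hk : Tendsto k atTop atTop)
    (hnk : ∀ t, ρl < Real.log (n t) / Real.log (k t) ∧ Real.log (n t) / Real.log (k t) < ρu)
    (A : ∀ t, Matrix (Fin (k t)) (Fin (k t)) ℝ) (hA : ∀ t, A t ∈ gapClass c α (k t)) :
    Tendsto (fun t => cycleLaw (n t) (k t)
      {ω | (ω.transition (A t)).IsIrreducible ∧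
        (k t : ℝ) / (n t * Real.log (k t) ^ γ) ≤ spectralGap (ω.transition (A t))})
      atTop (𝓝 1) := by
  have hlog : Tendsto (fun t => Real.log (k t)) atTop atTop :=
    Real.tendsto_log_atTop.comp (tendsto_natCast_atTop_atTop.comp hk)
  set C := 1024 * (3 * ρu + 1) with hC
  have hev : ∀ᶠ x : ℝ in atTop, 1 ≤ x ∧ Real.log 16 ≤ (ρl - 1) * x ∧
      4032 * (2 * C * x) ^ 2 ≤ Real.exp x ∧ 3 / 2 * (2 * C * x) * x ^ (-γ) ≤ 1 / 4 ∧
      9437184 * (3 / 2 * (2 * C * x) * x ^ (-γ)) * (2 * C * x) ^ 3 < c * x ^ (-α) := by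
    have e2 : Tendsto (fun x : ℝ => (ρl - 1) * x) atTop atTop :=
      tendsto_id.const_mul_atTop (by linarith)
    have e3 : Tendsto (fun x : ℝ => 4032 * (2 * C) ^ 2 * (x ^ 2 * Real.exp (-x))) atTop
        (𝓝 (4032 * (2 * C) ^ 2 * 0)) :=
      (Real.tendsto_pow_mul_exp_neg_atTop_nhds_zero 2).const_mul _
    rw [mul_zero] at e3
    have e4 := eventually_mul_rpow_lt (a := 1 - γ) (b := 0) (by linarith) (3 / 2 * (2 * C))
      (c := 1 / 4) (by norm_num)
    -- With `x = log k`, the bound on `ε` has order `x ^ (1 - γ)` and `m ^ 3` contributes `x ^ 3`;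
    -- the product must be below the gap `c * x ^ (-α)` of `A`.
    have e5 := eventually_mul_rpow_lt (a := 4 - γ) (b := -α) (by linarith)
      (9437184 * (3 / 2) * (2 * C) ^ 4) hc
    filter_upwards [eventually_ge_atTop 1, e2.eventually_ge_atTop (Real.log 16),
      e3.eventually_lt_const one_pos, e4, e5] with x h1 h2 h3 h4 h5
    have hx0 : 0 < x := by linarith
    refine ⟨h1, h2, ?_, ?_, ?_⟩
    · have h6 := mul_le_mul_of_nonneg_right h3.le (Real.exp_nonneg x)
      rw [one_mul] at h6
      refine le_trans (le_of_eq ?_) h6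
      rw [Real.exp_neg]
      field_simp
    · rw [Real.rpow_zero, mul_one, sub_eq_add_neg, Real.rpow_add hx0, Real.rpow_one] at h4
      linarith
    · have h6 : x ^ (4 - γ) = x ^ 4 * x ^ (-γ) := by
        rw [sub_eq_add_neg, Real.rpow_add hx0]; norm_cast
      rw [h6] at h5
      refine lt_of_eq_of_lt ?_ h5
      ring
  have hbound : ∀ᶠ t in atTop, 1 - ENNReal.ofReal (4 * Real.exp (-Real.log (k t))) ≤
      cycleLaw (n t) (k t) {ω | (ω.transition (A t)).IsIrreducible ∧
        (k t : ℝ) / (n t * Real.log (k t) ^ γ) ≤ spectralGap (ω.transition (A t))} ∧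
      cycleLaw (n t) (k t) {ω | (ω.transition (A t)).IsIrreducible ∧
        (k t : ℝ) / (n t * Real.log (k t) ^ γ) ≤ spectralGap (ω.transition (A t))} ≤ 1 := by
    filter_upwards [hlog.eventually hev, hk.eventually_gt_atTop 0, hn.eventually_gt_atTop 0]
      with t ht hk0 hn0
    obtain ⟨h1, h2, h3, h4, h5⟩ := ht
    have hkR : (0 : ℝ) < k t := by exact_mod_cast hk0
    have hnR : (0 : ℝ) < n t := by exact_mod_cast hn0
    rw [Real.exp_log hkR] at h3
    have hle := cycleLaw_compl_le hρl hρ (hA t) hc h1 (hnk t).1 (hnk t).2 hC h2 h3 h4 h5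
    have hkn : k t ≤ n t := by
      have h6 := (lt_div_iff₀ (by linarith : (0 : ℝ) < Real.log (k t))).1 (hnk t).1
      have h7 : Real.log (k t) ≤ Real.log (n t) := by nlinarith
      exact_mod_cast (Real.log_le_log_iff hkR hnR).1 h7
    have := CycleConfig.isProbabilityMeasure_cycleLaw hk0 hkn
    refine ⟨?_, MeasureTheory.prob_le_one⟩
    rw [MeasureTheory.prob_compl_eq_one_sub (MeasurableSpace.measurableSet_top)] at hle
    exact tsub_le_iff_tsub_le.1 hle
  have hlim : Tendsto (fun t => 1 - ENNReal.ofReal (4 * Real.exp (-Real.log (k t)))) atTop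
      (𝓝 1) := by
    have h1 : Tendsto (fun t => 4 * Real.exp (-Real.log (k t))) atTop (𝓝 (4 * 0)) :=
      ((Real.tendsto_exp_neg_atTop_nhds_zero).comp hlog).const_mul 4
    have h2 := ENNReal.Tendsto.sub (tendsto_const_nhds (x := (1 : ENNReal)))
      (ENNReal.tendsto_ofReal h1) (Or.inl ENNReal.one_ne_top)
    simpa using h2
  exact tendsto_of_tendsto_of_tendsto_of_le_of_le' hlim tendsto_const_nhds
    (hbound.mono fun _ h => h.1) (hbound.mono fun _ h => h.2)
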